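/- Let $\lambda>0$ and $a=\tfrac12(1+\lambda)\lambda^{\gamma}$ with $\gamma=\frac{1-\lambda}{1+\lambda}$. For $x>0$ and $\nu>0$ put $$\mathcal W^-_{\lambda,\nu}(x)=\Big(\frac x2\Big)^{\nu}\sum_{n=0}^\infty\frac{(-1)^n(x/2)^{(\lambda+1)n}}{n!\,\Gamma(\lambda n+\nu+1)},$$ and put $$h(u)=\tfrac12(e^u-e^{-\lambda u})-au,\qquad u_0=\frac{2\log\lambda}{1+\lambda},\qquad H=\lambda^{2/(1+\lambda)}(1+\lambda).$$ Then $h'(u_0)=h''(u_0)=0$ (so $u_0$ is a double saddle point of $h$), $H=2h'''(u_0)$, and $$h(u_0)=\frac{\lambda^2-1}{2\lambda^2}\,e^{u_0}-\lambda^{\gamma}\log\lambda .$$ There are an analytic function $u=u(w)$ near $w=0$ with $$-\tfrac13w^3=h(u)-h(u_0),\qquad u(0)=u_0,\qquad u'(0)=\frac{2^{2/3}e^{\pi i/3}}{H^{1/3}},$$ and real numbers $B_0,B_1,B_2,\dots$ such that, near $w=0$, $$\frac{du}{dw}=\frac{2^{2/3}}{H^{1/3}}\sum_{k\ge0}\frac{e^{\pi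 i(k+1)/3}B_k}{H^{k/3}}\,w^k .$$ These satisfy $$B_0=1,\quad B_1=\frac{\lambda-1}{2^{1/3}\cdot3},\quad B_2=\frac{1-6\lambda+\lambda^2}{2^{2/3}\cdot20},\quad B_3=\frac{5+93\lambda-93\lambda^2-5\lambda^3}{1620},$$ $$B_4=-\frac{277+836\lambda-6114\lambda^2+836\lambda^3+277\lambda^4}{2^{1/3}\cdot136080},$$ $$B_5=\frac{1-61\lambda-254\lambda^2+254\lambda^3+61\lambda^4-\lambda^5}{2^{2/3}\cdot16800},$$ $$B_6=\frac{959+7098\lambda-2031\lambda^2-58708\lambda^3-2031\lambda^4+7098\lambda^5+959\lambda^6}{10497600}.$$ As $x\to+\infty$ with $\nu=ax$, $$\mathcal W^-_{\lambda,\nu}(x)\sim\frac{2^{2/3}e^{xh(u_0)}}{3\pi(Hx/3)^{1/3}}\sum_{k\ge0}\frac{B_k}{(Hx/3)^{k/3}}\,\Gamma\Big(\frac{k+1}3\Big)\sin\frac{\pi(k+1)}3$$ in the sense of Poincaré: for every integer $N\ge0$, the difference between the left side and the right side with the sum restricted to $0\le k<N$ is $$O\big(e^{xh(u_0)}(Hx/3)^{-(N+1)/3}\big)\qquad(x\to+\infty).$$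 The terms of the series with $k\equiv2\pmod 3$ vanish. -/

import Mathlib

open Filter Topology Asymptotics

noncomputable section

/-- The Wright function `W_{lam, mu}(z) = ∑ z ^ n / (n! Γ(lam n + mu))` for real arguments. -/
def wright (lam mu z : ℝ) : ℝ :=
  ∑' n : ℕ, z ^ n / ((n.factorial : ℝ) * Real.Gamma (lam * n + mu))

/-- `𝒲⁻_{lam, nu}(x) = (x/2) ^ nu * W_{lam, nu + 1}(-(x/2) ^ (lam + 1))`. -/
def wrightMinus (lam nu x : ℝ) : ℝ :=
  (x / 2) ^ nu * wright lam (nu + 1) (-(x / 2) ^ (lam + 1))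

/-- The phase function `h(u) = (e ^ u - e ^ (-lam u)) / 2 - a u`. -/
def phase (lam a : ℝ) (u : ℂ) : ℂ :=
  (Complex.exp u - Complex.exp (-(lam : ℂ) * u)) / 2 - (a : ℂ) * u

/-- The double saddle `u₀ = 2 log lam / (1 + lam)`. -/
def doubleSaddle (lam : ℝ) : ℝ := 2 * Real.log lam / (1 + lam)

/-- The constant `H = lam ^ (2 / (1 + lam)) * (1 + lam)`. -/
def bigH (lam : ℝ) : ℝ := lam ^ (2 / (1 + lam)) * (1 + lam)

/-- The local inverse `u = U(w)` of `-w³/3 = h(u) - h(u₀)` at the double saddle, on the branch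
`u - u₀ = 2^(2/3) e^(πi/3) H^(-1/3) w + ⋯` which for `w > 0` describes the upper half of the path
of steepest descent. -/
structure IsUpperBranch (lam a : ℝ) (U : ℂ → ℂ) : Prop where
  analyticAt : AnalyticAt ℂ U 0
  map_zero : U 0 = (doubleSaddle lam : ℂ)
  deriv_zero : deriv U 0 =
    (((2 : ℝ) ^ (2 / 3 : ℝ) / bigH lam ^ (1 / 3 : ℝ) : ℝ) : ℂ) *
      Complex.exp ((Real.pi : ℂ) * Complex.I / 3)
  phase_eq : ∀ᶠ w in 𝓝 (0 : ℂ),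
    phase lam a (U w) - phase lam a (doubleSaddle lam : ℂ) = -w ^ 3 / 3

/-- The real numbers `B k` are the coefficients in the power series expansion
`du/dw = 2^(2/3) H^(-1/3) ∑ₖ e^(πi(k+1)/3) B k H^(-k/3) w^k`
on the upper branch. -/
def IsSaddleCoeff (lam a : ℝ) (B : ℕ → ℝ) : Prop :=
  ∃ U : ℂ → ℂ, IsUpperBranch lam a U ∧
    ∀ᶠ w in 𝓝 (0 : ℂ), HasSum
      (fun k : ℕ =>
        (((2 : ℝ) ^ (2 / 3 : ℝ) / bigH lam ^ (1 / 3 : ℝ) : ℝ) : ℂ) *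
          (Complex.exp ((Real.pi : ℂ) * Complex.I * ((k : ℂ) + 1) / 3) *
            ((B k / bigH lam ^ ((k : ℝ) / 3) : ℝ) : ℂ) * w ^ k))
      (deriv U w)

/-- The factor `2^(2/3) e^(x h(u₀)) / (3 π (H x / 3)^(1/3))`. -/
def saddlePrefactor (lam a x : ℝ) : ℝ :=
  (2 : ℝ) ^ (2 / 3 : ℝ) * Real.exp (x * (phase lam a (doubleSaddle lam : ℂ)).re) /
    (3 * Real.pi * (bigH lam * x / 3) ^ (1 / 3 : ℝ))

/-- The `k`-th term `B k (H x / 3)^(-k/3) Γ((k+1)/3) sin(π (k+1) / 3)` of the series. -/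
def saddleTerm (lam : ℝ) (B : ℕ → ℝ) (k : ℕ) (x : ℝ) : ℝ :=
  B k / (bigH lam * x / 3) ^ ((k : ℝ) / 3) * Real.Gamma (((k : ℝ) + 1) / 3) *
    Real.sin (Real.pi / 3 * ((k : ℝ) + 1))

end

/-! Inserting Laplace's integral for `1 / Γ` over the line `Re z = 1` into the series and
substituting `z = (x/2) e^u` shows that `2πi 𝒲⁻` is the integral of `e^(x h(u))` along a curve
symmetric about the real axis, whose ends tend to `+∞ ± iπ/2`. The integrand is entire. With `P` its
primitive vanishing at `u₀`, Cauchy's theorem amounts to taking differences of `P`, and the symmetry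
leaves `π 𝒲⁻ = Im lim P(ρ + iπ/2)` (`pi_mul_wrightMinus`). Any path from `u₀` to `+∞ + iπ/2` may
therefore be used.

At the double saddle `h(u₀ + t) - h(u₀) = (H/12) K(t)` with `K = saddleShift lam` and `K(t) = t³ +
O(t⁴)`, so `arg t = π/3` is a direction of descent. The path is the exact steepest descent curve
`U([0, δ])`, a short segment from `U(δ)` to the tangent ray `u₀ + r(1 + i√3)`, that ray up to height
`π/2`, and then a horizontal half line. The steepest path thus never has to be followed globally:
off the first piece it suffices that `Re K < 0`, with linear decay on the half line
(`re_saddleShift_ray_neg`, `re_saddleShift_horizontal_le`, `eventually_re_saddleShift_neg`), and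
these pieces are exponentially smaller than `e^(x h(u₀))`. On the first piece the phase is exactly
`-w³/3`, and `cubic_watson` gives the expansion. The sines are the imaginary parts of
`e^(πi(k+1)/3)`.

For the coefficients, let `T` be the local solution of `K(T(z)) = z³`, `T'(0) = 1`. Then `U(w) = u₀
+ T(κw)` with `Hκ³ = -4`, and `T` has real Taylor coefficients because it commutes with conjugation.
The derivatives of `K` satisfy a linear differential equation, which turns the chain rule into a
closed recursion for the coefficients of `T'` (`cubic_inverse_coeff_recursion`). -/

noncomputable section

/-! ### The double saddle and the phase recentred there. -/

section SaddleIdentities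

variable {lam a : ℝ}

lemma exp_doubleSaddle (hlam : 0 < lam) :
    Real.exp (doubleSaddle lam) = lam ^ (2 / (1 + lam)) := by
  rw [Real.rpow_def_of_pos hlam, doubleSaddle]; congr 1; ring

lemma exp_neg_mul_doubleSaddle (hlam : 0 < lam) :
    Real.exp (-lam * doubleSaddle lam) = Real.exp (doubleSaddle lam) / lam ^ 2 := by
  have h : lam ^ 2 = Real.exp (2 * Real.log lam) := by
    rw [mul_comm, Real.exp_mul, Real.exp_log hlam]; norm_cast
  rw [h, ← Real.exp_sub]; congr 1
  unfold doubleSaddle; field_simp; ring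

lemma rpow_gamma_eq (hlam : 0 < lam) :
    lam ^ ((1 - lam) / (1 + lam)) = Real.exp (doubleSaddle lam) / lam := by
  have h : Real.exp (doubleSaddle lam) / lam
      = Real.exp (doubleSaddle lam) / Real.exp (Real.log lam) := by rw [Real.exp_log hlam]
  rw [h, ← Real.exp_sub, Real.rpow_def_of_pos hlam]; congr 1
  unfold doubleSaddle; field_simp; ring

lemma bigH_eq (hlam : 0 < lam) : bigH lam = Real.exp (doubleSaddle lam) * (1 + lam) := by
  rw [bigH, exp_doubleSaddle hlam]

lemma bigH_pos (hlam : 0 < lam) : 0 < bigH lam := by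
  rw [bigH_eq hlam]; positivity

lemma hasDerivAt_cexp_neg_mul (lam : ℝ) (u : ℂ) :
    HasDerivAt (fun u : ℂ => Complex.exp (-(lam : ℂ) * u))
      (-(lam : ℂ) * Complex.exp (-(lam : ℂ) * u)) u := by
  simpa [mul_comm] using ((hasDerivAt_id u).const_mul (-(lam : ℂ))).cexp

lemma hasDerivAt_phase (lam a : ℝ) (u : ℂ) : HasDerivAt (phase lam a)
    ((Complex.exp u + lam * Complex.exp (-(lam : ℂ) * u)) / 2 - a) u := by
  have h := (((Complex.hasDerivAt_exp u).sub (hasDerivAt_cexp_neg_mul lam u)).div_const 2).sub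
    ((hasDerivAt_id u).const_mul (a : ℂ))
  exact h.congr_deriv (by ring)

lemma differentiable_phase (lam a : ℝ) : Differentiable ℂ (phase lam a) :=
  fun u => (hasDerivAt_phase lam a u).differentiableAt

lemma deriv_phase (lam a : ℝ) : deriv (phase lam a) =
    fun u => (Complex.exp u + lam * Complex.exp (-(lam : ℂ) * u)) / 2 - a :=
  funext fun u => (hasDerivAt_phase lam a u).deriv

lemma iteratedDeriv_two_phase (lam a : ℝ) : iteratedDeriv 2 (phase lam a) =
    fun u => (Complex.exp u - lam ^ 2 * Complex.exp (-(lam : ℂ) * u)) / 2 := by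
  rw [iteratedDeriv_succ, iteratedDeriv_one, deriv_phase]
  funext u
  refine HasDerivAt.deriv ?_
  have h := (((Complex.hasDerivAt_exp u).add
    ((hasDerivAt_cexp_neg_mul lam u).const_mul (lam : ℂ))).div_const 2).sub_const (a : ℂ)
  exact h.congr_deriv (by ring)

lemma iteratedDeriv_three_phase (lam a : ℝ) : iteratedDeriv 3 (phase lam a) =
    fun u => (Complex.exp u + lam ^ 3 * Complex.exp (-(lam : ℂ) * u)) / 2 := by
  rw [iteratedDeriv_succ, iteratedDeriv_two_phase]
  funext u
  refine HasDerivAt.deriv ?_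
  have h := ((Complex.hasDerivAt_exp u).sub
    ((hasDerivAt_cexp_neg_mul lam u).const_mul ((lam : ℂ) ^ 2))).div_const 2
  exact h.congr_deriv (by ring)

lemma cexp_neg_mul_doubleSaddle (hlam : 0 < lam) :
    Complex.exp (-(lam : ℂ) * (doubleSaddle lam : ℂ)) =
      ((Real.exp (doubleSaddle lam) / lam ^ 2 : ℝ) : ℂ) := by
  rw [← exp_neg_mul_doubleSaddle hlam]; push_cast; rfl

lemma speed_eq (hlam : 0 < lam) (ha : a = (1 + lam) / 2 * lam ^ ((1 - lam) / (1 + lam))) :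
    a = (1 + lam) / (2 * lam) * Real.exp (doubleSaddle lam) := by
  rw [ha, rpow_gamma_eq hlam]; field_simp

lemma speed_pos (hlam : 0 < lam) (ha : a = (1 + lam) / 2 * lam ^ ((1 - lam) / (1 + lam))) :
    0 < a := by
  rw [ha]; positivity

lemma deriv_phase_doubleSaddle (hlam : 0 < lam)
    (ha : a = (1 + lam) / 2 * lam ^ ((1 - lam) / (1 + lam))) :
    deriv (phase lam a) (doubleSaddle lam : ℂ) = 0 := by
  simp only [deriv_phase, cexp_neg_mul_doubleSaddle hlam, speed_eq hlam ha]
  have : (lam : ℂ) ≠ 0 := by exact_mod_cast hlam.ne'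
  push_cast
  field_simp
  ring

lemma iteratedDeriv_two_phase_doubleSaddle (hlam : 0 < lam) :
    iteratedDeriv 2 (phase lam a) (doubleSaddle lam : ℂ) = 0 := by
  simp only [iteratedDeriv_two_phase, cexp_neg_mul_doubleSaddle hlam]
  have : (lam : ℂ) ≠ 0 := by exact_mod_cast hlam.ne'
  push_cast
  field_simp
  ring

lemma iteratedDeriv_three_phase_doubleSaddle (hlam : 0 < lam) :
    (bigH lam : ℂ) = 2 * iteratedDeriv 3 (phase lam a) (doubleSaddle lam : ℂ) := by
  simp only [iteratedDeriv_three_phase, cexp_neg_mul_doubleSaddle hlam, bigH_eq hlam]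
  have : (lam : ℂ) ≠ 0 := by exact_mod_cast hlam.ne'
  push_cast
  field_simp

lemma phase_doubleSaddle (hlam : 0 < lam)
    (ha : a = (1 + lam) / 2 * lam ^ ((1 - lam) / (1 + lam))) :
    phase lam a (doubleSaddle lam : ℂ) =
      (((lam ^ 2 - 1) / (2 * lam ^ 2) * Real.exp (doubleSaddle lam) -
        lam ^ ((1 - lam) / (1 + lam)) * Real.log lam : ℝ) : ℂ) := by
  have h2 : (1 + lam) ≠ 0 := by positivity
  have h3 : a * doubleSaddle lam = lam ^ ((1 - lam) / (1 + lam)) * Real.log lam := by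
    rw [ha, doubleSaddle]; field_simp
  rw [phase, cexp_neg_mul_doubleSaddle hlam, ← h3]
  have : (lam : ℂ) ≠ 0 := by exact_mod_cast hlam.ne'
  push_cast
  field_simp

/-- The phase function recentred at the double saddle and normalised so that
`saddleShift lam t = t ^ 3 + O(t ^ 4)`. -/
def saddleShift (lam : ℝ) (t : ℂ) : ℂ :=
  6 / (1 + lam) * (Complex.exp t - 1 - (Complex.exp (-(lam : ℂ) * t) - 1) / lam ^ 2
    - (1 + 1 / lam) * t)

/-- At the saddle `e^(-lam u₀)` and `a` are both multiples of `e^(u₀)` by rational functions of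
`lam`, so `e^(u₀)` factors out and the recentred phase depends on `lam` alone. The constant `H/12`
is `h'''(u₀)/6`. -/
lemma phase_doubleSaddle_add (hlam : 0 < lam)
    (ha : a = (1 + lam) / 2 * lam ^ ((1 - lam) / (1 + lam))) (t : ℂ) :
    phase lam a (doubleSaddle lam + t) =
      phase lam a (doubleSaddle lam) + bigH lam / 12 * saddleShift lam t := by
  have h1 : (lam : ℂ) ≠ 0 := by exact_mod_cast hlam.ne'
  have h2 : (1 + lam : ℂ) ≠ 0 := by exact_mod_cast (by positivity : (1 + lam) ≠ 0)
  simp only [phase, saddleShift, mul_add, Complex.exp_add, cexp_neg_mul_doubleSaddle hlam,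
    bigH_eq hlam, speed_eq hlam ha]
  push_cast
  field_simp
  ring

lemma hasDerivAt_saddleShift (hlam : 0 < lam) (t : ℂ) : HasDerivAt (saddleShift lam)
    (6 / (1 + lam) * (Complex.exp t + Complex.exp (-(lam : ℂ) * t) / lam - (1 + 1 / lam))) t := by
  have h1 : (lam : ℂ) ≠ 0 := by exact_mod_cast hlam.ne'
  have h := ((((Complex.hasDerivAt_exp t).sub_const 1).sub
    (((hasDerivAt_cexp_neg_mul lam t).sub_const 1).div_const ((lam : ℂ) ^ 2))).sub
    ((hasDerivAt_id t).const_mul (1 + 1 / (lam : ℂ)))).const_mul (6 / (1 + (lam : ℂ)))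
  exact h.congr_deriv (by field_simp; ring)

lemma re_saddleShift (lam ρ θ : ℝ) : (saddleShift lam (ρ + θ * Complex.I)).re =
    6 / (1 + lam) * (Real.exp ρ * Real.cos θ - 1
      - (Real.exp (-lam * ρ) * Real.cos (lam * θ) - 1) / lam ^ 2 - (1 + 1 / lam) * ρ) := by
  have h : saddleShift lam (ρ + θ * Complex.I) = ((6 / (1 + lam) : ℝ) : ℂ) *
      (Complex.exp (ρ + θ * Complex.I) - 1 -
        (Complex.exp ((-lam * ρ : ℝ) + (-lam * θ : ℝ) * Complex.I) - 1) / ((lam ^ 2 : ℝ) : ℂ)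
        - ((1 + 1 / lam : ℝ) : ℂ) * (ρ + θ * Complex.I)) := by
    unfold saddleShift; push_cast; congr 5; ring_nf
  rw [h]
  simp only [Complex.sub_re, Complex.div_ofReal_re, Complex.exp_re,
    Complex.add_re, Complex.add_im, Complex.ofReal_re, Complex.ofReal_im,
    Complex.mul_re, Complex.mul_im, Complex.I_re, Complex.I_im, Complex.one_re, neg_mul,
        Real.cos_neg, mul_zero,
    mul_one, zero_mul, sub_zero, add_zero, zero_add]

end SaddleIdentities

/-! ### Descent along the ray of angle π/3 and along the line of height π/2. -/

section SteepDescent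

lemma neg_of_deriv_neg {g g' : ℝ → ℝ} {b : ℝ} (hg : ∀ x, HasDerivAt g (g' x) x) (h0 : g 0 = 0)
    (hneg : ∀ x, 0 < x → x < b → g' x < 0) {x : ℝ} (hx : 0 < x) (hxb : x ≤ b) : g x < 0 := by
  have hanti : StrictAntiOn g (Set.Icc 0 b) := by
    refine strictAntiOn_of_deriv_neg (convex_Icc 0 b)
      (fun y _ => (hg y).continuousAt.continuousWithinAt) fun y hy => ?_
    rw [interior_Icc] at hy
    rw [(hg y).deriv]
    exact hneg y hy.1 hy.2
  simpa [h0] using hanti ⟨le_rfl, hx.le.trans hxb⟩ ⟨hx.le, hxb⟩ hx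

lemma hasDerivAt_exp_mul_cos_sin (c s A B x : ℝ) : HasDerivAt
    (fun x => Real.exp (c * x) * (A * Real.cos (s * x) + B * Real.sin (s * x)))
    (Real.exp (c * x) * ((c * A + s * B) * Real.cos (s * x) +
      (c * B - s * A) * Real.sin (s * x))) x := by
  have h1 : HasDerivAt (fun x => c * x) c x := by simpa using (hasDerivAt_id x).const_mul c
  have h2 : HasDerivAt (fun x => s * x) s x := by simpa using (hasDerivAt_id x).const_mul s
  exact (h1.exp.mul ((h2.cos.const_mul A).add (h2.sin.const_mul B))).congr_deriv
    (by simp only [Pi.add_apply]; ring)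

lemma cos_sqrt_three_mul_pos {x : ℝ} (hx : 0 < x) (hxb : x < Real.pi / (2 * √3)) :
    0 < Real.cos (√3 * x) := by
  have h3 : 0 < √3 := by positivity
  rw [lt_div_iff₀ (by positivity)] at hxb
  exact Real.cos_pos_of_mem_Ioo ⟨by nlinarith [Real.pi_pos, mul_pos h3 hx], by linarith⟩

/-- The first summand is `Re e^((1 + i√3)x) = 1 + x - x² - 4x³/3 + ⋯`. The left side and its first
two derivatives vanish at `0`, and the third derivative is `-8 e^x cos(√3 x)`, because `(1 + i√3)³ =
-8`; it is negative as long as `√3 x < π/2`. Three integrations from `0` give the sign. -/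
lemma exp_mul_cos_lt {x : ℝ} (hx : 0 < x) (hxb : x ≤ Real.pi / (2 * √3)) :
    Real.exp x * Real.cos (√3 * x) - 1 - x + x ^ 2 < 0 := by
  have hs : √3 * √3 = 3 := Real.mul_self_sqrt (by norm_num)
  have d1 (y : ℝ) := hasDerivAt_exp_mul_cos_sin 1 (√3) 1 0 y
  have d2 (y : ℝ) := hasDerivAt_exp_mul_cos_sin 1 (√3) 1 (-√3) y
  have d3 (y : ℝ) := hasDerivAt_exp_mul_cos_sin 1 (√3) (-2) (-2 * √3) y
  have key2 : ∀ y, 0 < y → y < Real.pi / (2 * √3) → Real.exp (1 * y) *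
      ((-2) * Real.cos (√3 * y) + (-2 * √3) * Real.sin (√3 * y)) + 2 < 0 := by
    intro y hy hyb
    refine neg_of_deriv_neg (fun z => (d3 z).add_const 2) (by simp) (fun z hz hzb => ?_) hy hyb.le
    have := mul_pos (Real.exp_pos (1 * z)) (cos_sqrt_three_mul_pos hz hzb)
    nlinarith
  have key1 : ∀ y, 0 < y → y < Real.pi / (2 * √3) → Real.exp (1 * y) *
      (1 * Real.cos (√3 * y) + (-√3) * Real.sin (√3 * y)) + (2 * y - 1) < 0 := by
    intro y hy hyb
    refine neg_of_deriv_neg (fun z => (d2 z).add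
      ((((hasDerivAt_id z).const_mul 2).sub_const 1))) (by simp) (fun z hz hzb => ?_) hy hyb.le
    have := key2 z hz hzb
    linear_combination this - Real.exp (1 * z) * Real.cos (√3 * z) * hs
  have := neg_of_deriv_neg (g := fun z => Real.exp (1 * z) *
      (1 * Real.cos (√3 * z) + 0 * Real.sin (√3 * z)) + (z ^ 2 - z - 1))
    (fun z => (d1 z).add (((hasDerivAt_pow 2 z).sub (hasDerivAt_id z)).sub_const 1))
    (by simp) (fun z hz hzb => ?_) hx hxb
  · simp only [one_mul, zero_mul, add_zero] at this
    linarith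
  · have := key1 z hz hzb
    norm_num at this ⊢
    linear_combination this

/-- The companion for the other exponential, with third derivative `8 e^(-x) cos(√3 x)`. There is no
upper bound on `x` because it is applied at `lam * r` with `lam` arbitrary. -/
lemma le_exp_neg_mul_cos {x : ℝ} (hx : 0 < x) :
    0 ≤ Real.exp (-x) * Real.cos (√3 * x) - 1 + x + x ^ 2 := by
  have hs : √3 * √3 = 3 := Real.mul_self_sqrt (by norm_num)
  rcases le_or_gt x (Real.pi / (2 * √3)) with hxb | hxb
  · have d1 (y : ℝ) := hasDerivAt_exp_mul_cos_sin (-1) (√3) (-1) 0 y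
    have d2 (y : ℝ) := hasDerivAt_exp_mul_cos_sin (-1) (√3) 1 (√3) y
    have d3 (y : ℝ) := hasDerivAt_exp_mul_cos_sin (-1) (√3) 2 (-2 * √3) y
    have key2 : ∀ y, 0 < y → y < Real.pi / (2 * √3) → Real.exp (-1 * y) *
        (2 * Real.cos (√3 * y) + (-2 * √3) * Real.sin (√3 * y)) - 2 < 0 := by
      intro y hy hyb
      refine neg_of_deriv_neg (fun z => (d3 z).sub_const 2) (by simp) (fun z hz hzb => ?_) hy hyb.le
      have := mul_pos (Real.exp_pos (-1 * z)) (cos_sqrt_three_mul_pos hz hzb)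
      nlinarith
    have key1 : ∀ y, 0 < y → y < Real.pi / (2 * √3) → Real.exp (-1 * y) *
        (1 * Real.cos (√3 * y) + √3 * Real.sin (√3 * y)) - (2 * y + 1) < 0 := by
      intro y hy hyb
      refine neg_of_deriv_neg (fun z => (d2 z).sub
        ((((hasDerivAt_id z).const_mul 2).add_const 1))) (by simp) (fun z hz hzb => ?_) hy hyb.le
      have := key2 z hz hzb
      linear_combination this + Real.exp (-1 * z) * Real.cos (√3 * z) * hs
    have := neg_of_deriv_neg (g := fun z => Real.exp (-1 * z) *
        ((-1) * Real.cos (√3 * z) + 0 * Real.sin (√3 * z)) - (z ^ 2 + z - 1))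
      (fun z => (d1 z).sub (((hasDerivAt_pow 2 z).add (hasDerivAt_id z)).sub_const 1))
      (by simp) (fun z hz hzb => ?_) hx hxb
    · simp only [neg_mul, one_mul, zero_mul, add_zero] at this
      linarith
    · have := key1 z hz hzb
      norm_num at this ⊢
      linear_combination this
  -- Beyond `π/(2√3) > 0.9` the cosine may be negative, but crude bounds suffice: `x + x² - 1 >
  -- 0.7`, while `e^(-x) ≤ 0.6`.
  · have h3 : √3 ≤ 1.74 := by
      rw [Real.sqrt_le_left (by norm_num)]; norm_num
    have hx9 : 0.9 < x := by
      refine lt_of_le_of_lt ?_ hxb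
      rw [le_div_iff₀ (by positivity)]
      nlinarith [Real.pi_gt_d2]
    have h1 : -Real.exp (-x) ≤ Real.exp (-x) * Real.cos (√3 * x) := by
      nlinarith [Real.neg_one_le_cos (√3 * x), Real.exp_pos (-x)]
    have h2 : Real.exp (-x) ≤ 0.6 := by
      have h4 : Real.exp (-x) * Real.exp x = 1 := by rw [← Real.exp_add]; simp
      nlinarith [Real.add_one_le_exp x, Real.exp_pos (-x)]
    nlinarith

lemma re_saddleShift_ray_neg {lam : ℝ} (hlam : 0 < lam) {r : ℝ} (hr : 0 < r)
    (hrb : r ≤ Real.pi / (2 * √3)) :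
    (saddleShift lam (r * (1 + √3 * Complex.I))).re < 0 := by
  have h1 : (r * (1 + √3 * Complex.I) : ℂ) = (r : ℂ) + ((√3 * r : ℝ) : ℂ) * Complex.I := by
    push_cast; ring
  have h2 := le_exp_neg_mul_cos (mul_pos hlam hr)
  have h3 := exp_mul_cos_lt hr hrb
  have h4 : lam * (√3 * r) = √3 * (lam * r) := by ring
  rw [h1, re_saddleShift, h4, neg_mul]
  refine mul_neg_of_pos_of_neg (by positivity) ?_
  -- The quadratic terms `r²` and `(lam r)² / lam²` cancel, reflecting the vanishing second
  -- derivative at the saddle, so the two one-variable inequalities decouple.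
  have h5 : Real.exp r * Real.cos (√3 * r) - 1 -
      (Real.exp (-(lam * r)) * Real.cos (√3 * (lam * r)) - 1) / lam ^ 2 - (1 + 1 / lam) * r =
      (Real.exp r * Real.cos (√3 * r) - 1 - r + r ^ 2) -
      (Real.exp (-(lam * r)) * Real.cos (√3 * (lam * r)) - 1 + lam * r + (lam * r) ^ 2)
        / lam ^ 2 := by
    field_simp; ring
  rw [h5]
  have : 0 ≤ (Real.exp (-(lam * r)) * Real.cos (√3 * (lam * r)) - 1 + lam * r + (lam * r) ^ 2)
        / lam ^ 2 := by positivity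
  linarith

/-- At height `π/2` the factor `cos θ = 0` removes the growing exponential. The other exponential
can offset at most the part `(ρ - ρ₀)/lam` of the linear decrease `(1 + 1/lam)(ρ - ρ₀)`, which
leaves slope `-1` before normalisation. -/
lemma re_saddleShift_horizontal_le {lam : ℝ} (hlam : 0 < lam) {ρ₀ ρ : ℝ} (h0 : 0 ≤ ρ₀)
    (hρ : ρ₀ ≤ ρ) :
    (saddleShift lam (ρ + (Real.pi / 2 : ℝ) * Complex.I)).re ≤
      (saddleShift lam (ρ₀ + (Real.pi / 2 : ℝ) * Complex.I)).re - 6 / (1 + lam) * (ρ - ρ₀) := by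
  have hd : 0 ≤ Real.exp (-lam * ρ₀) - Real.exp (-lam * ρ) := by
    rw [sub_nonneg, Real.exp_le_exp]; nlinarith
  have hd' : Real.exp (-lam * ρ₀) - Real.exp (-lam * ρ) ≤ lam * (ρ - ρ₀) := by
    have h1 : Real.exp (-lam * ρ) =
        Real.exp (-lam * ρ₀) * Real.exp (-lam * (ρ - ρ₀)) := by
      rw [← Real.exp_add]; ring_nf
    have h2 := Real.add_one_le_exp (-lam * (ρ - ρ₀))
    have h3 : Real.exp (-lam * ρ₀) ≤ 1 := Real.exp_le_one_iff.2 (by nlinarith)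
    have h4 : 0 ≤ lam * (ρ - ρ₀) := mul_nonneg hlam.le (by linarith)
    rw [h1]
    nlinarith [Real.exp_pos (-lam * ρ₀)]
  rw [re_saddleShift, re_saddleShift, Real.cos_pi_div_two]
  rw [← sub_nonneg]
  have hc : Real.cos (lam * (Real.pi / 2)) * (Real.exp (-lam * ρ₀) - Real.exp (-lam * ρ))
      ≤ lam * (ρ - ρ₀) :=
    le_trans (mul_le_of_le_one_left hd (Real.cos_le_one _)) hd'
  have key : 0 ≤ 6 / (1 + lam) * ((lam * (ρ - ρ₀) - Real.cos (lam * (Real.pi / 2)) *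
      (Real.exp (-lam * ρ₀) - Real.exp (-lam * ρ))) / lam ^ 2) :=
    mul_nonneg (by positivity) (div_nonneg (by linarith) (by positivity))
  refine key.trans_eq ?_
  field_simp
  ring

end SteepDescent

/-! ### Laplace's integral for 1/Γ by Fourier inversion of the Gamma density. -/

section ReciprocalGamma

open MeasureTheory

open scoped FourierTransform

/-- The unnormalised Gamma density `t ^ (s - 1) e ^ (-t)` on the positive half line. -/
def gammaKernel (s : ℝ) (t : ℝ) : ℂ :=
  Set.indicator (Set.Ioi 0) (fun t : ℝ => ((t ^ (s - 1) * Real.exp (-t) : ℝ) : ℂ)) t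

lemma integrableOn_rpow_mul_exp_neg {s : ℝ} (hs : 0 < s) :
    IntegrableOn (fun t : ℝ => t ^ (s - 1) * Real.exp (-t)) (Set.Ioi 0) := by
  simpa [mul_comm] using Real.GammaIntegral_convergent hs

lemma integrable_gammaKernel {s : ℝ} (hs : 0 < s) : Integrable (gammaKernel s) := by
  unfold gammaKernel
  rw [integrable_indicator_iff measurableSet_Ioi]
  exact (integrableOn_rpow_mul_exp_neg hs).ofReal

lemma mul_gammaKernel {s : ℝ} (t : ℝ) : (t : ℂ) * gammaKernel s t = gammaKernel (s + 1) t := by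
  unfold gammaKernel
  by_cases ht : t ∈ Set.Ioi (0 : ℝ)
  · have h : t ^ (s + 1 - 1) = t * t ^ (s - 1) := by
      rw [show s + 1 - 1 = 1 + (s - 1) by ring, Real.rpow_add ht, Real.rpow_one]
    rw [Set.indicator_of_mem ht, Set.indicator_of_mem ht, h]
    push_cast; ring
  · rw [Set.indicator_of_notMem ht, Set.indicator_of_notMem ht, mul_zero]

lemma continuous_gammaKernel {s : ℝ} (hs : 1 < s) : Continuous (gammaKernel s) := by
  have h : gammaKernel s = fun t => (((max t 0) ^ (s - 1) * Real.exp (-t) : ℝ) : ℂ) := by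
    funext t
    unfold gammaKernel
    by_cases ht : t ∈ Set.Ioi (0 : ℝ)
    · rw [Set.indicator_of_mem ht, max_eq_left (le_of_lt ht)]
    · rw [Set.indicator_of_notMem ht, max_eq_right (not_lt.1 ht),
        Real.zero_rpow (by linarith), zero_mul, Complex.ofReal_zero]
  rw [h]
  have : Continuous fun t : ℝ => (max t 0) ^ (s - 1) :=
    (continuous_id.max continuous_const).rpow_const fun _ => Or.inr (by linarith)
  fun_prop

lemma fourier_gammaKernel_eq (s w : ℝ) : 𝓕 (gammaKernel s) w = ∫ t in Set.Ioi (0 : ℝ),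
    ((t ^ (s - 1) : ℝ) : ℂ) * Complex.exp (-(1 + 2 * Real.pi * w * Complex.I) * t) := by
  rw [Real.fourier_real_eq_integral_exp_smul, ← integral_indicator measurableSet_Ioi]
  congr 1
  funext t
  unfold gammaKernel
  by_cases ht : t ∈ Set.Ioi (0 : ℝ)
  · rw [Set.indicator_of_mem ht, Set.indicator_of_mem ht, smul_eq_mul,
      Complex.ofReal_mul (t ^ (s - 1)), mul_left_comm, Complex.ofReal_exp, ← Complex.exp_add]
    congr 2
    push_cast; ring
  · rw [Set.indicator_of_notMem ht, Set.indicator_of_notMem ht, smul_zero]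

lemma integrableOn_rpow_mul_cexp {s : ℝ} (hs : 0 < s) (w : ℝ) :
    IntegrableOn (fun t : ℝ => ((t ^ (s - 1) : ℝ) : ℂ) *
      Complex.exp (-(1 + 2 * Real.pi * w * Complex.I) * t)) (Set.Ioi 0) := by
  refine (integrableOn_rpow_mul_exp_neg hs).mono' ?_ ?_
  · refine ContinuousOn.aestronglyMeasurable ?_ measurableSet_Ioi
    refine ContinuousOn.mul ?_ (by fun_prop)
    refine Complex.continuous_ofReal.comp_continuousOn ?_
    exact continuousOn_id.rpow_const fun x hx => Or.inl (ne_of_gt hx)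
  · refine (ae_restrict_iff' measurableSet_Ioi).2 (Eventually.of_forall fun t ht => ?_)
    rw [norm_mul, Complex.norm_real, Real.norm_of_nonneg (Real.rpow_nonneg (le_of_lt ht) _),
      Complex.norm_exp]
    simp

/-- Integration by parts: the derivative of `t^s e^(-rt)` has integral zero over the half line,
since the function vanishes at both ends. -/
lemma fourier_gammaKernel_succ {s : ℝ} (hs : 0 < s) (w : ℝ) :
    (1 + 2 * Real.pi * w * Complex.I) * 𝓕 (gammaKernel (s + 1)) w = s * 𝓕 (gammaKernel s) w := by
  set r : ℂ := 1 + 2 * Real.pi * w * Complex.I with hr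
  have hd : ∀ t ∈ Set.Ioi (0 : ℝ), HasDerivAt
      (fun t : ℝ => ((t ^ s : ℝ) : ℂ) * Complex.exp (-r * t))
      (s * (((t ^ (s - 1) : ℝ) : ℂ) * Complex.exp (-r * t)) -
        r * (((t ^ (s + 1 - 1) : ℝ) : ℂ) * Complex.exp (-r * t))) t := by
    intro t ht
    have h1 := (Real.hasDerivAt_rpow_const (p := s) (Or.inl (ne_of_gt ht))).ofReal_comp
    have h2 : HasDerivAt (fun t : ℝ => Complex.exp (-r * t)) (-r * Complex.exp (-r * t)) t := by
      have := ((hasDerivAt_id (t : ℂ)).const_mul (-r)).cexp.comp_ofReal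
      simpa [mul_comm] using this
    refine (h1.mul h2).congr_deriv ?_
    rw [add_sub_cancel_right]
    push_cast; ring
  have hint := ((integrableOn_rpow_mul_cexp hs w).const_mul (s : ℂ)).sub
    ((integrableOn_rpow_mul_cexp (by linarith : 0 < s + 1) w).const_mul r)
  have hlim : Tendsto (fun t : ℝ => ((t ^ s : ℝ) : ℂ) * Complex.exp (-r * t)) atTop (𝓝 0) := by
    rw [tendsto_zero_iff_norm_tendsto_zero]
    refine (tendsto_rpow_mul_exp_neg_mul_atTop_nhds_zero s 1 one_pos).congr' ?_
    filter_upwards [eventually_ge_atTop 0] with t ht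
    rw [norm_mul, Complex.norm_real, Real.norm_of_nonneg (Real.rpow_nonneg ht _),
      Complex.norm_exp]
    simp [hr]
  have hcont : ContinuousWithinAt (fun t : ℝ => ((t ^ s : ℝ) : ℂ) * Complex.exp (-r * t))
      (Set.Ici 0) 0 := by
    refine ContinuousAt.continuousWithinAt (ContinuousAt.mul ?_ (by fun_prop))
    exact Complex.continuous_ofReal.continuousAt.comp
      (continuousAt_id.rpow_const (Or.inr hs.le))
  have key := integral_Ioi_of_hasDerivAt_of_tendsto hcont hd hint hlim
  rw [integral_sub ((integrableOn_rpow_mul_cexp hs w).const_mul (s : ℂ))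
    ((integrableOn_rpow_mul_cexp (by linarith : 0 < s + 1) w).const_mul r),
    integral_const_mul, integral_const_mul, ← fourier_gammaKernel_eq,
    ← fourier_gammaKernel_eq, Real.zero_rpow hs.ne'] at key
  simp only [Complex.ofReal_zero, zero_mul, sub_zero] at key
  exact (sub_eq_zero.1 key).symm

lemma re_one_add_mul_I (y : ℝ) : (1 + (y : ℂ) * Complex.I).re = 1 := by simp

lemma one_add_mul_I_mem_slitPlane (y : ℝ) : 1 + (y : ℂ) * Complex.I ∈ Complex.slitPlane :=
  Or.inl (by simp)

lemma one_add_mul_I_ne_zero (y : ℝ) : 1 + (y : ℂ) * Complex.I ≠ 0 :=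
  Complex.slitPlane_ne_zero (one_add_mul_I_mem_slitPlane y)

/-- Differentiating in `w` multiplies the kernel by `-2πi t`, raising `s` to `s + 1`, and
`fourier_gammaKernel_succ` brings it back to `s`. The resulting first order equation says that the
transform times `(1 + 2πiw)^s` is constant; its value at `w = 0` is Euler's integral. -/
lemma fourier_gammaKernel {s : ℝ} (hs : 0 < s) (w : ℝ) : 𝓕 (gammaKernel s) w =
    Real.Gamma s * (1 + ((2 * Real.pi * w : ℝ) : ℂ) * Complex.I) ^ (-(s : ℂ)) := by
  set r : ℝ → ℂ := fun w => 1 + ((2 * Real.pi * w : ℝ) : ℂ) * Complex.I with hr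
  have hr0 (w : ℝ) : r w ≠ 0 := one_add_mul_I_ne_zero _
  have hrd (w : ℝ) : HasDerivAt r (2 * Real.pi * Complex.I) w := by
    have h := (((hasDerivAt_id w).const_mul (2 * Real.pi)).ofReal_comp.mul_const
      Complex.I).const_add 1
    exact h.congr_deriv (by push_cast; ring)
  have hG (w : ℝ) : HasDerivAt (𝓕 (gammaKernel s))
      (-(2 * Real.pi * Complex.I) * 𝓕 (gammaKernel (s + 1)) w) w := by
    have h := Real.hasDerivAt_fourier (integrable_gammaKernel hs)
      (w := w) (by
        refine (integrable_gammaKernel (by linarith : 0 < s + 1)).congr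
          (Eventually.of_forall fun t => ?_)
        simp only [Complex.real_smul, mul_gammaKernel])
    refine h.congr_deriv ?_
    rw [Real.fourier_real_eq, Real.fourier_real_eq, ← integral_const_mul]
    congr 1; funext t
    simp only [← mul_gammaKernel, Circle.smul_def, smul_eq_mul]
    ring
  have hprod (w : ℝ) : HasDerivAt (fun w => 𝓕 (gammaKernel s) w * r w ^ (s : ℂ)) 0 w := by
    have h1 : HasDerivAt (fun w => r w ^ (s : ℂ))
        ((s : ℂ) * r w ^ ((s : ℂ) - 1) * (2 * Real.pi * Complex.I)) w := by
      have h : HasDerivAt (fun z : ℂ => z ^ (s : ℂ)) ((s : ℂ) * r w ^ ((s : ℂ) - 1)) (r w) :=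
        (Complex.hasStrictDerivAt_cpow_const (one_add_mul_I_mem_slitPlane _)).hasDerivAt
      exact h.comp w (hrd w)
    refine ((hG w).mul h1).congr_deriv ?_
    have h2 := fourier_gammaKernel_succ hs w
    have h3 : r w = 1 + 2 * Real.pi * w * Complex.I := by simp [hr]
    rw [← h3] at h2
    rw [Complex.cpow_sub _ _ (hr0 w), Complex.cpow_one]
    have := hr0 w
    field_simp
    linear_combination -2 * Real.pi * Complex.I * r w ^ (s : ℂ) * h2
  have hconst := is_const_of_deriv_eq_zero (fun w => (hprod w).differentiableAt)
    (fun w => (hprod w).deriv) w 0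
  have h0 : 𝓕 (gammaKernel s) 0 = Real.Gamma s := by
    rw [fourier_gammaKernel_eq, Real.Gamma_eq_integral hs, ← integral_complex_ofReal]
    congr 1; funext t
    push_cast; simp [mul_comm]
  have hr00 : r 0 = 1 := by simp [hr]
  rw [h0, hr00, Complex.one_cpow, mul_one] at hconst
  rw [← hconst, Complex.cpow_neg, mul_assoc,
    mul_inv_cancel₀ (by rw [Complex.cpow_ne_zero_iff]; exact Or.inl (hr0 w)), mul_one]

lemma norm_one_add_mul_I_cpow (s y : ℝ) :
    ‖(1 + (y : ℂ) * Complex.I) ^ (-(s : ℂ))‖ = (1 + ‖y‖ ^ 2) ^ (-s / 2) := by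
  have h1 : ‖1 + (y : ℂ) * Complex.I‖ = √(1 + ‖y‖ ^ 2) := by
    have := Complex.norm_add_mul_I 1 y
    rw [Complex.ofReal_one] at this
    rw [this, one_pow, Real.norm_eq_abs, sq_abs]
  rw [← Complex.ofReal_neg, Complex.norm_cpow_real, h1, Real.sqrt_eq_rpow,
    ← Real.rpow_mul (by positivity)]
  congr 1; ring

lemma integrable_one_add_mul_I_cpow {s : ℝ} (hs : 1 < s) :
    Integrable fun y : ℝ => (1 + (y : ℂ) * Complex.I) ^ (-(s : ℂ)) := by
  have h : Continuous fun y : ℝ => (1 + (y : ℂ) * Complex.I) ^ (-(s : ℂ)) := by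
    refine Continuous.cpow ?_ continuous_const fun y => one_add_mul_I_mem_slitPlane y
    fun_prop
  refine Integrable.mono' (integrable_rpow_neg_one_add_norm_sq (E := ℝ) (r := s)
    (by simpa using hs)) h.aestronglyMeasurable (Eventually.of_forall fun y => ?_)
  rw [norm_one_add_mul_I_cpow]

/-- Laplace's integral for the reciprocal Gamma function. -/
lemma integral_cexp_mul_cpow_neg {s : ℝ} (hs : 1 < s) :
    ∫ y : ℝ, Complex.exp (1 + (y : ℂ) * Complex.I) * (1 + (y : ℂ) * Complex.I) ^ (-(s : ℂ)) =
      2 * Real.pi / Real.Gamma s := by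
  have hs0 : 0 < s := by linarith
  have hΓ : (Real.Gamma s : ℂ) ≠ 0 := by exact_mod_cast (Real.Gamma_pos_of_pos hs0).ne'
  set g : ℝ → ℂ := fun y => Complex.exp ((y : ℂ) * Complex.I) *
    (1 + (y : ℂ) * Complex.I) ^ (-(s : ℂ)) with hg
  have hF : 𝓕 (gammaKernel s) = fun w => Real.Gamma s *
      (1 + ((2 * Real.pi * w : ℝ) : ℂ) * Complex.I) ^ (-(s : ℂ)) :=
    funext fun w => fourier_gammaKernel hs0 w
  have hFint : Integrable (𝓕 (gammaKernel s)) := by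
    rw [hF]
    exact ((integrable_one_add_mul_I_cpow hs).comp_mul_left' (R := 2 * Real.pi)
      (by positivity)).const_mul _
  -- Inversion at `t = 1`, where the kernel equals `e^(-1)` whatever `s` is. Pointwise inversion
  -- uses `s > 1` twice: for continuity of the kernel at `0` and for integrability of its transform.
  have hinv := congrFun ((continuous_gammaKernel hs).fourierInv_fourier_eq
    (integrable_gammaKernel hs0) hFint) 1
  rw [Real.fourierInv_eq'] at hinv
  have h1 : ∀ w : ℝ, Complex.exp (((2 * Real.pi * inner ℝ w (1 : ℝ) : ℝ) : ℂ) * Complex.I) •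
      𝓕 (gammaKernel s) w = Real.Gamma s * g (2 * Real.pi * w) := by
    intro w
    rw [hF, hg]
    simp; ring
  simp_rw [h1] at hinv
  rw [integral_const_mul, Measure.integral_comp_mul_left] at hinv
  have h2 : gammaKernel s 1 = Complex.exp (-1) := by
    unfold gammaKernel
    rw [Set.indicator_of_mem (by simp)]; simp
  have h3 : |(2 * Real.pi)⁻¹| = (2 * Real.pi)⁻¹ := abs_of_pos (by positivity)
  rw [h2, h3, Complex.real_smul] at hinv
  have h4 : (fun y : ℝ => Complex.exp (1 + (y : ℂ) * Complex.I) *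
      (1 + (y : ℂ) * Complex.I) ^ (-(s : ℂ))) = fun y => Complex.exp 1 * g y := by
    funext y; rw [Complex.exp_add, hg, mul_assoc]
  rw [h4, integral_const_mul]
  have hpi : (Real.pi : ℂ) ≠ 0 := by exact_mod_cast Real.pi_ne_zero
  have he : Complex.exp 1 * Complex.exp (-1) = 1 := by rw [← Complex.exp_add]; simp
  push_cast at hinv
  rw [eq_div_iff hΓ]
  field_simp at hinv
  linear_combination Complex.exp 1 * hinv + 2 * Real.pi * he

end ReciprocalGamma

/-! ### The Wright function as an integral of e^(x h). -/

section LaplaceRepresentation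

open MeasureTheory

variable {lam a x : ℝ}

/-- The principal logarithm along the line `Re z = 1`, shifted by `log (x / 2)`. -/
def logLine (x y : ℝ) : ℂ := Complex.log (1 + (y : ℂ) * Complex.I) - (Real.log (x / 2) : ℝ)

lemma cexp_mul_logLine (hx : 0 < x) (c y : ℝ) : Complex.exp ((c : ℂ) * logLine x y) =
    (1 + (y : ℂ) * Complex.I) ^ (c : ℂ) * (((x / 2) ^ (-c) : ℝ) : ℂ) := by
  rw [logLine, Complex.cpow_def_of_ne_zero (one_add_mul_I_ne_zero y),
    Real.rpow_def_of_pos (by positivity), Complex.ofReal_exp, ← Complex.exp_add]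
  congr 1; push_cast; ring

/-- With `z = 1 + iy` and `u = log z - log(x/2)` one has `x h(u) = z - (x/2)^(lam+1) z^(-lam) - a x
u`. The division by `z` is the Jacobian, as `du = dz / z`. -/
lemma cexp_phase_logLine (hx : 0 < x) (a lam y : ℝ) :
    Complex.exp (x * phase lam a (logLine x y)) / (1 + (y : ℂ) * Complex.I) =
      (((x / 2) ^ (a * x) : ℝ) : ℂ) * (Complex.exp (1 + (y : ℂ) * Complex.I) *
        (1 + (y : ℂ) * Complex.I) ^ (-((a * x + 1 : ℝ) : ℂ)) *
        Complex.exp (((-(x / 2) ^ (lam + 1) : ℝ) : ℂ) *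
          (1 + (y : ℂ) * Complex.I) ^ (-(lam : ℂ)))) := by
  have hz := one_add_mul_I_ne_zero y
  have hx2 : 0 < x / 2 := by positivity
  have h1 := cexp_mul_logLine hx 1 y
  have h2 := cexp_mul_logLine hx (-lam) y
  have h3 := cexp_mul_logLine hx (-(a * x)) y
  have hlam1 : (x / 2) ^ (lam + 1) = (x / 2) ^ lam * (x / 2) := by
    rw [Real.rpow_add hx2, Real.rpow_one]
  have hinv : (x / 2) ^ (-1 : ℝ) = (x / 2)⁻¹ := Real.rpow_neg_one _
  rw [hinv, Complex.ofReal_one, one_mul, Complex.cpow_one] at h1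
  rw [neg_neg, Complex.ofReal_neg] at h2 h3
  have hcp : (1 + (y : ℂ) * Complex.I) ^ (-((a * x + 1 : ℝ) : ℂ)) =
      (1 + (y : ℂ) * Complex.I) ^ (-((a * x : ℝ) : ℂ)) / (1 + (y : ℂ) * Complex.I) := by
    rw [Complex.ofReal_add, neg_add, Complex.cpow_add _ _ hz, Complex.ofReal_one,
      Complex.cpow_neg_one, div_eq_mul_inv]
  have hsplit : (x : ℂ) * phase lam a (logLine x y) =
      (1 + (y : ℂ) * Complex.I) + ((-(x / 2) ^ (lam + 1) : ℝ) : ℂ) *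
          (1 + (y : ℂ) * Complex.I) ^ (-(lam : ℂ)) + -((a * x : ℝ) : ℂ) * logLine x y := by
    rw [phase, h1, h2, hlam1]
    have : (x : ℂ) ≠ 0 := by exact_mod_cast hx.ne'
    push_cast
    field_simp
    ring
  rw [hsplit, Complex.exp_add, Complex.exp_add, h3, hcp]
  ring

lemma one_le_norm_one_add_mul_I (y : ℝ) : 1 ≤ ‖1 + (y : ℂ) * Complex.I‖ := by
  simpa using Complex.abs_re_le_norm (1 + (y : ℂ) * Complex.I)

lemma norm_one_add_mul_I_cpow_neg_le {c : ℝ} (hc : 0 ≤ c) (y : ℝ) :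
    ‖(1 + (y : ℂ) * Complex.I) ^ (-(c : ℂ))‖ ≤ 1 := by
  rw [← Complex.ofReal_neg, Complex.norm_cpow_real]
  exact Real.rpow_le_one_of_one_le_of_nonpos (one_le_norm_one_add_mul_I y) (by linarith)

lemma norm_cexp_one_add_mul_I (y : ℝ) :
    ‖Complex.exp (1 + (y : ℂ) * Complex.I)‖ = Real.exp 1 := by
  rw [Complex.norm_exp, re_one_add_mul_I]

lemma continuous_one_add_mul_I_cpow (s : ℂ) :
    Continuous fun y : ℝ => (1 + (y : ℂ) * Complex.I) ^ s :=
  Continuous.cpow (by fun_prop) continuous_const fun y => one_add_mul_I_mem_slitPlane y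

lemma integrable_cexp_phase_logLine (hlam : 0 < lam) (ha : 0 < a) (hx : 0 < x) :
    Integrable fun y : ℝ =>
      Complex.exp (x * phase lam a (logLine x y)) / (1 + (y : ℂ) * Complex.I) := by
  simp_rw [cexp_phase_logLine hx]
  refine Integrable.const_mul ?_ _
  have hs : 1 < a * x + 1 := by have := mul_pos ha hx; linarith
  have c1 := continuous_one_add_mul_I_cpow (-((a * x + 1 : ℝ) : ℂ))
  have c2 := continuous_one_add_mul_I_cpow (-(lam : ℂ))
  refine Integrable.mono' (((integrable_one_add_mul_I_cpow hs).norm.const_mul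
    (Real.exp 1)).mul_const (Real.exp ((x / 2) ^ (lam + 1))))
    (Continuous.aestronglyMeasurable (by fun_prop)) (Eventually.of_forall fun y => ?_)
  rw [norm_mul, norm_mul, norm_cexp_one_add_mul_I]
  refine mul_le_mul_of_nonneg_left ?_ (by positivity)
  refine (Complex.norm_exp_le_exp_norm _).trans (Real.exp_le_exp.2 ?_)
  rw [norm_mul, Complex.norm_real, norm_neg, Real.norm_of_nonneg (by positivity)]
  exact mul_le_of_le_one_right (by positivity) (norm_one_add_mul_I_cpow_neg_le hlam.le y)

/-- Expanding `exp(-M z^(-lam))` and integrating termwise gives one reciprocal Gamma function per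
term. The interchange holds because `|z| ≥ 1` on the line, so the `n`-th term is at most `M^n / n!`
times a fixed integrable function. -/
lemma two_pi_mul_wrightMinus (hlam : 0 < lam) (ha : 0 < a) (hx : 0 < x) :
    2 * Real.pi * (wrightMinus lam (a * x) x : ℂ) = ∫ y : ℝ,
      Complex.exp (x * phase lam a (logLine x y)) / (1 + (y : ℂ) * Complex.I) := by
  have hs : 1 < a * x + 1 := by have := mul_pos ha hx; linarith
  set M : ℝ := (x / 2) ^ (lam + 1) with hM
  have hM0 : 0 ≤ M := by positivity
  have hsn (n : ℕ) : a * x + 1 ≤ lam * n + (a * x + 1) := by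
    have : 0 ≤ lam * n := by positivity
    linarith
  set F : ℕ → ℝ → ℂ := fun n y => (((-M) ^ n / n.factorial : ℝ) : ℂ) *
    (Complex.exp (1 + (y : ℂ) * Complex.I) *
      (1 + (y : ℂ) * Complex.I) ^ (-((lam * n + (a * x + 1) : ℝ) : ℂ))) with hF
  have hcpow (n : ℕ) (y : ℝ) : (1 + (y : ℂ) * Complex.I) ^ (-((lam * n + (a * x + 1) : ℝ) : ℂ)) =
      ((1 + (y : ℂ) * Complex.I) ^ (-(lam : ℂ))) ^ n *
        (1 + (y : ℂ) * Complex.I) ^ (-((a * x + 1 : ℝ) : ℂ)) := by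
    rw [← Complex.cpow_mul_nat, ← Complex.cpow_add _ _ (one_add_mul_I_ne_zero y)]
    congr 1; push_cast; ring
  have hbound (n : ℕ) (y : ℝ) : ‖F n y‖ ≤ M ^ n / n.factorial * (Real.exp 1 *
      ‖(1 + (y : ℂ) * Complex.I) ^ (-((a * x + 1 : ℝ) : ℂ))‖) := by
    rw [hF]
    simp only
    rw [norm_mul, norm_mul, norm_cexp_one_add_mul_I, hcpow, norm_mul, norm_pow, Complex.norm_real,
      norm_div, norm_pow, norm_neg, Real.norm_of_nonneg hM0, Real.norm_natCast]
    gcongr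
    exact mul_le_of_le_one_left (norm_nonneg _)
      (pow_le_one₀ (norm_nonneg _) (norm_one_add_mul_I_cpow_neg_le hlam.le y))
  have hdom := ((integrable_one_add_mul_I_cpow hs).norm.const_mul (Real.exp 1))
  have hFint (n : ℕ) : Integrable (F n) := by
    have c1 := continuous_one_add_mul_I_cpow (-((lam * n + (a * x + 1) : ℝ) : ℂ))
    exact Integrable.mono' (hdom.const_mul _) (Continuous.aestronglyMeasurable (by fun_prop))
      (Eventually.of_forall fun y => hbound n y)
  have hsum : Summable fun n => ∫ y, ‖F n y‖ := by
    refine Summable.of_nonneg_of_le (fun n => integral_nonneg fun y => norm_nonneg _)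
      (fun n => integral_mono (hFint n).norm (hdom.const_mul _) (hbound n)) ?_
    simp_rw [integral_const_mul]
    exact (Real.summable_pow_div_factorial M).mul_right _
  have key := hasSum_integral_of_summable_integral_norm hFint hsum
  have hval (n : ℕ) : ∫ y, F n y = ((2 * Real.pi * ((-M) ^ n /
      ((n.factorial : ℝ) * Real.Gamma (lam * n + (a * x + 1)))) : ℝ) : ℂ) := by
    rw [hF]
    simp only
    rw [integral_const_mul, integral_cexp_mul_cpow_neg (hs.trans_le (hsn n))]
    push_cast
    rw [div_mul_div_comm, mul_comm, mul_div_assoc]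
  have htsum (y : ℝ) : (((x / 2) ^ (a * x) : ℝ) : ℂ) * ∑' n, F n y =
      Complex.exp (x * phase lam a (logLine x y)) / (1 + (y : ℂ) * Complex.I) := by
    rw [cexp_phase_logLine hx]
    congr 1
    have he := NormedSpace.expSeries_div_hasSum_exp
      (((-M : ℝ) : ℂ) * (1 + (y : ℂ) * Complex.I) ^ (-(lam : ℂ)))
    rw [← Complex.exp_eq_exp_ℂ] at he
    rw [← (he.mul_left (Complex.exp (1 + (y : ℂ) * Complex.I) *
        (1 + (y : ℂ) * Complex.I) ^ (-((a * x + 1 : ℝ) : ℂ)))).tsum_eq]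
    congr 1; funext n
    rw [hF]
    simp only
    rw [hcpow, mul_pow]
    push_cast; ring
  have htot : ∫ y : ℝ, Complex.exp (x * phase lam a (logLine x y)) / (1 + (y : ℂ) * Complex.I) =
      (((x / 2) ^ (a * x) : ℝ) : ℂ) * ∫ y, ∑' n, F n y := by
    rw [← integral_const_mul]
    simp_rw [htsum]
  simp_rw [hval] at key
  rw [htot, ← key.tsum_eq, ← Complex.ofReal_tsum, tsum_mul_left, wrightMinus, wright]
  push_cast; ring

end LaplaceRepresentation

/-! ### Replacing the contour by any path to +∞ + iπ/2. -/

section ContourDeformation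

open MeasureTheory

open scoped ComplexConjugate

variable {lam a x : ℝ}

lemma phase_conj (lam a : ℝ) (u : ℂ) : phase lam a (conj u) = conj (phase lam a u) := by
  unfold phase
  have h2 : conj (2 : ℂ) = 2 := Complex.conj_ofNat 2
  simp [← Complex.exp_conj, h2]

/-- The integrand `e ^ (x h(u))` has an entire primitive vanishing at the double saddle. -/
lemma exists_primitive (lam a x : ℝ) : ∃ P : ℂ → ℂ, P (doubleSaddle lam) = 0 ∧
    (∀ u, HasDerivAt P (Complex.exp (x * phase lam a u)) u) ∧ ∀ u, P (conj u) = conj (P u) := by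
  have hd : Differentiable ℂ fun u => Complex.exp (x * phase lam a u) :=
    ((differentiable_phase lam a).const_mul _).cexp
  obtain ⟨P, hP0, hP⟩ := hd.isExactOn_univ.with_val_at (doubleSaddle lam : ℂ) 0
  have hP' (u : ℂ) := hP u (Set.mem_univ u)
  refine ⟨P, hP0, hP', fun u => ?_⟩
  -- The reflected function is another primitive of the same integrand, and the two agree at the
  -- real point `u₀`.
  have hc (u : ℂ) : HasDerivAt (conj ∘ P ∘ conj) (Complex.exp (x * phase lam a u)) u := by
    have h := (hP' (conj u)).conj_conj
    rw [phase_conj] at h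
    simpa [← Complex.exp_conj] using h
  have hconst := is_const_of_deriv_eq_zero
    (f := conj ∘ P ∘ conj - P)
    (fun u => ((hc u).sub (hP' u)).differentiableAt)
    (fun u => by rw [((hc u).sub (hP' u)).deriv, sub_self]) u (doubleSaddle lam : ℂ)
  simp only [Pi.sub_apply, Function.comp_apply, Complex.conj_ofReal, hP0, map_zero, sub_self]
      at hconst
  have := congrArg conj (sub_eq_zero.1 hconst)
  simpa using this

lemma re_phase (lam a ρ θ : ℝ) : (phase lam a (ρ + θ * Complex.I)).re =
    (Real.exp ρ * Real.cos θ - Real.exp (-lam * ρ) * Real.cos (lam * θ)) / 2 - a * ρ := by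
  have h : phase lam a (ρ + θ * Complex.I) = (Complex.exp (ρ + θ * Complex.I) -
      Complex.exp ((-lam * ρ : ℝ) + (-lam * θ : ℝ) * Complex.I)) / ((2 : ℝ) : ℂ) -
      (a : ℂ) * (ρ + θ * Complex.I) := by
    unfold phase; push_cast; congr 4; ring_nf
  rw [h]
  simp only [Complex.sub_re, Complex.div_ofReal_re, Complex.exp_re, Complex.add_re,
    Complex.add_im, Complex.ofReal_re, Complex.ofReal_im, Complex.mul_re, Complex.mul_im,
    Complex.I_re, Complex.I_im, neg_mul, Real.cos_neg, mul_zero, mul_one, zero_mul, sub_zero,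
    add_zero, zero_add]

lemma exp_re_logLine (hx : 0 < x) (y : ℝ) :
    Real.exp (logLine x y).re = ‖1 + (y : ℂ) * Complex.I‖ / (x / 2) := by
  rw [logLine, Complex.sub_re, Complex.ofReal_re, Complex.log_re, Real.exp_sub, Real.exp_log
    (norm_pos_iff.2 (one_add_mul_I_ne_zero y)), Real.exp_log (by positivity)]

lemma logLine_im (x y : ℝ) : (logLine x y).im = Complex.arg (1 + (y : ℂ) * Complex.I) := by
  rw [logLine, Complex.sub_im, Complex.ofReal_im, Complex.log_im, sub_zero]

lemma tendsto_re_logLine (hx : 0 < x) : Tendsto (fun y => (logLine x y).re) atTop atTop := by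
  have h : Tendsto (fun y : ℝ => Real.exp (logLine x y).re) atTop atTop := by
    simp_rw [exp_re_logLine hx]
    refine Tendsto.atTop_div_const (by positivity) ?_
    refine tendsto_atTop_mono (fun y => ?_) tendsto_id
    have := Complex.abs_im_le_norm (1 + (y : ℂ) * Complex.I)
    exact (le_abs_self y).trans (by simpa using this)
  simpa [Function.comp_def] using Real.tendsto_log_atTop.comp h

lemma hasDerivAt_logLine (x y : ℝ) :
    HasDerivAt (logLine x) (Complex.I / (1 + (y : ℂ) * Complex.I)) y := by
  have h : HasDerivAt (fun y : ℝ => 1 + (y : ℂ) * Complex.I) Complex.I y := by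
    have := (((hasDerivAt_id y).ofReal_comp).mul_const Complex.I).const_add 1
    simpa using this
  exact (h.clog_real (one_add_mul_I_mem_slitPlane y)).sub_const _

lemma logLine_neg (x y : ℝ) : logLine x (-y) = conj (logLine x y) := by
  rw [logLine, logLine, map_sub, Complex.conj_ofReal, ← Complex.log_conj]
  · simp
  · exact (Complex.mem_slitPlane_iff_arg.1 (one_add_mul_I_mem_slitPlane y)).1

lemma re_phase_le_of_mem_strip (hlam : 0 < lam) {ρ θ θ₀ : ℝ} (hρ : 0 ≤ ρ) (h0 : 0 ≤ θ₀)
    (hθ : θ₀ ≤ θ) (hθ' : θ ≤ Real.pi / 2) : (phase lam a (ρ + θ * Complex.I)).re ≤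
      (Real.exp ρ * Real.cos θ₀ + 1) / 2 - a * ρ := by
  rw [re_phase]
  have h1 : Real.cos θ ≤ Real.cos θ₀ := Real.cos_le_cos_of_nonneg_of_le_pi h0
    (by linarith [Real.pi_pos]) hθ
  have h2 : Real.exp (-lam * ρ) ≤ 1 := Real.exp_le_one_iff.2 (by nlinarith)
  have h3 := Real.neg_one_le_cos (lam * θ)
  have h4 := mul_le_mul_of_nonneg_left h1 (Real.exp_pos ρ).le
  have h5 : -1 ≤ Real.exp (-lam * ρ) * Real.cos (lam * θ) := by
    nlinarith [Real.exp_pos (-lam * ρ)]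
  linarith

/-- The curve `logLine` only approaches height `π/2`, so each of its points is joined to that height
by a vertical segment. There `e^ρ cos θ` is at most its value at the lower end, which is the
constant `Re e^u = 2/x` because `Re z = 1`. The integrand is then at most `e^(1 + x/2 - axρ)`, which
tends to `0`. -/
lemma tendsto_primitive_logLine (hlam : 0 < lam) (ha : 0 < a) (hx : 0 < x) {P : ℂ → ℂ}
    (hP : ∀ u, HasDerivAt P (Complex.exp (x * phase lam a u)) u) {L : ℂ}
    (hL : Tendsto (fun ρ : ℝ => P (ρ + (Real.pi / 2 : ℝ) * Complex.I)) atTop (𝓝 L)) :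
    Tendsto (fun y => P (logLine x y)) atTop (𝓝 L) := by
  have h1 := hL.comp (tendsto_re_logLine hx)
  have h2 : Tendsto (fun y : ℝ => P (logLine x y) -
      P ((logLine x y).re + (Real.pi / 2 : ℝ) * Complex.I)) atTop (𝓝 0) := by
    have hbd : Tendsto (fun y : ℝ => Real.exp (1 + x / 2 + -(a * x) * (logLine x y).re) *
        (Real.pi / 2)) atTop (𝓝 0) := by
      rw [show (0 : ℝ) = 0 * (Real.pi / 2) by ring]
      refine Tendsto.mul_const _ (Real.tendsto_exp_atBot.comp ?_)
      exact tendsto_atBot_add_const_left _ _ ((tendsto_re_logLine hx).const_mul_atTop_of_neg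
        (by have := mul_pos ha hx; linarith))
    refine squeeze_zero_norm' ?_ hbd
    filter_upwards [eventually_ge_atTop 0, (tendsto_re_logLine hx).eventually_ge_atTop 0]
      with y hy hρ
    set ρ := (logLine x y).re with hρdef
    set θ₀ := (logLine x y).im with hθdef
    have hθ0 : 0 ≤ θ₀ := by
      rw [hθdef, logLine_im, Complex.arg_nonneg_iff]; simpa using hy
    have hθ1 : θ₀ ≤ Real.pi / 2 := by
      rw [hθdef, logLine_im]
      exact (abs_le.1 (Complex.abs_arg_le_pi_div_two_iff.2 (by simp))).2
    have hexp : Real.exp ρ * Real.cos θ₀ = 2 / x := by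
      have hn : 0 < ‖1 + (y : ℂ) * Complex.I‖ := norm_pos_iff.2 (one_add_mul_I_ne_zero y)
      rw [hρdef, exp_re_logLine hx, hθdef, logLine_im, Complex.cos_arg (one_add_mul_I_ne_zero y),
        re_one_add_mul_I]
      field_simp
    have hseg : ∀ θ ∈ Set.Icc θ₀ (Real.pi / 2), HasDerivWithinAt
        (fun θ : ℝ => P (ρ + θ * Complex.I))
        (Complex.exp (x * phase lam a (ρ + θ * Complex.I)) * Complex.I)
        (Set.Icc θ₀ (Real.pi / 2)) θ := by
      intro θ _
      have h3 : HasDerivAt (fun θ : ℝ => (ρ : ℂ) + θ * Complex.I) Complex.I θ := by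
        have := (((hasDerivAt_id θ).ofReal_comp).mul_const Complex.I).const_add (ρ : ℂ)
        simpa using this
      exact ((hP _).comp θ h3).hasDerivWithinAt
    have hnorm : ∀ θ ∈ Set.Icc θ₀ (Real.pi / 2),
        ‖Complex.exp (x * phase lam a (ρ + θ * Complex.I)) * Complex.I‖ ≤
          Real.exp (1 + x / 2 + -(a * x) * ρ) := by
      intro θ hθ
      rw [norm_mul, Complex.norm_I, mul_one, Complex.norm_exp, Complex.re_ofReal_mul]
      refine Real.exp_le_exp.2 ?_
      have h3 := mul_le_mul_of_nonneg_left
        (re_phase_le_of_mem_strip (a := a) hlam hρ hθ0 hθ.1 hθ.2) hx.le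
      rw [hexp] at h3
      refine h3.trans_eq ?_
      field_simp
      ring
    have h3 := (convex_Icc θ₀ (Real.pi / 2)).norm_image_sub_le_of_norm_hasDerivWithin_le
      hseg hnorm (Set.right_mem_Icc.2 hθ1) (Set.left_mem_Icc.2 hθ1)
    have h4 : (ρ : ℂ) + θ₀ * Complex.I = logLine x y := Complex.re_add_im _
    rw [h4] at h3
    refine h3.trans (mul_le_mul_of_nonneg_left ?_ (Real.exp_pos _).le)
    rw [Real.norm_eq_abs, abs_le]
    constructor <;> linarith
  simpa using h2.add h1

/-- The Wright function as the imaginary part of the integral over any path from the double saddle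
to `+∞ + iπ/2`. -/
lemma pi_mul_wrightMinus (hlam : 0 < lam) (ha : 0 < a) (hx : 0 < x) {P : ℂ → ℂ}
    (hP : ∀ u, HasDerivAt P (Complex.exp (x * phase lam a u)) u)
    (hconj : ∀ u, P (conj u) = conj (P u)) {L : ℂ}
    (hL : Tendsto (fun ρ : ℝ => P (ρ + (Real.pi / 2 : ℝ) * Complex.I)) atTop (𝓝 L)) :
    Real.pi * wrightMinus lam (a * x) x = L.im := by
  have htop := tendsto_primitive_logLine hlam ha hx hP hL
  have hbot : Tendsto (fun y => P (logLine x y)) atBot (𝓝 (conj L)) := by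
    have h := (Complex.continuous_conj.tendsto L).comp (htop.comp tendsto_neg_atBot_atTop)
    refine h.congr fun y => ?_
    simp only [Function.comp_apply]
    rw [← hconj, ← logLine_neg, neg_neg]
  have hd (y : ℝ) : HasDerivAt (fun y => P (logLine x y))
      (Complex.I * (Complex.exp (x * phase lam a (logLine x y)) /
        (1 + (y : ℂ) * Complex.I))) y :=
    ((hP _).comp y (hasDerivAt_logLine x y)).congr_deriv (by ring)
  have h := integral_of_hasDerivAt_of_tendsto hd
    ((integrable_cexp_phase_logLine hlam ha hx).const_mul Complex.I) hbot htop
  rw [integral_const_mul, ← two_pi_mul_wrightMinus hlam ha hx, Complex.sub_conj] at h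
  -- The two ends contribute `L - conj L = 2i Im L`, to be compared with `i · 2π 𝒲⁻`.
  have h2 : (2 * Complex.I) * ((Real.pi * wrightMinus lam (a * x) x : ℝ) : ℂ) =
      (2 * Complex.I) * (L.im : ℂ) := by
    rw [Complex.ofReal_mul]
    push_cast at h
    linear_combination h
  exact Complex.ofReal_injective (mul_left_cancel₀ (by simp) h2)

end ContourDeformation

/-! ### Local inversion of the cubic contact. -/

section LocalInverse

open scoped ComplexConjugate

variable {lam : ℝ}

/-- The derivative of `saddleShift lam`. -/
def saddleShift₁ (lam : ℝ) (t : ℂ) : ℂ :=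
  6 / (1 + lam) * (Complex.exp t + Complex.exp (-(lam : ℂ) * t) / lam - (1 + 1 / lam))

/-- The second derivative of `saddleShift lam`. -/
def saddleShift₂ (lam : ℝ) (t : ℂ) : ℂ :=
  6 / (1 + lam) * (Complex.exp t - Complex.exp (-(lam : ℂ) * t))

/-- The third derivative of `saddleShift lam`. -/
def saddleShift₃ (lam : ℝ) (t : ℂ) : ℂ :=
  6 / (1 + lam) * (Complex.exp t + lam * Complex.exp (-(lam : ℂ) * t))

lemma hasDerivAt_saddleShift₁ (hlam : 0 < lam) (t : ℂ) :
    HasDerivAt (saddleShift₁ lam) (saddleShift₂ lam t) t := by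
  have h1 : (lam : ℂ) ≠ 0 := by exact_mod_cast hlam.ne'
  have h := (((Complex.hasDerivAt_exp t).add
    ((hasDerivAt_cexp_neg_mul lam t).div_const (lam : ℂ))).sub_const
    (1 + 1 / (lam : ℂ))).const_mul (6 / (1 + (lam : ℂ)))
  exact h.congr_deriv (by unfold saddleShift₂; field_simp; ring)

lemma hasDerivAt_saddleShift₂ (lam : ℝ) (t : ℂ) :
    HasDerivAt (saddleShift₂ lam) (saddleShift₃ lam t) t := by
  have h := ((Complex.hasDerivAt_exp t).sub (hasDerivAt_cexp_neg_mul lam t)).const_mul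
    (6 / (1 + (lam : ℂ)))
  exact h.congr_deriv (by unfold saddleShift₃; ring)

/-- Both `e^t` and `e^(-lam t)` are annihilated by `(D - 1)(D + lam)`. Hence the chain of
derivatives closes on the second and third ones, which is what makes the coefficient recursion
finite. -/
lemma hasDerivAt_saddleShift₃ (lam : ℝ) (t : ℂ) :
    HasDerivAt (saddleShift₃ lam) ((1 - lam) * saddleShift₃ lam t + lam * saddleShift₂ lam t)
        t := by
  have h := ((Complex.hasDerivAt_exp t).add
    ((hasDerivAt_cexp_neg_mul lam t).const_mul (lam : ℂ))).const_mul (6 / (1 + (lam : ℂ)))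
  exact h.congr_deriv (by unfold saddleShift₃ saddleShift₂; ring)

lemma saddleShift_zero (lam : ℝ) : saddleShift lam 0 = 0 := by simp [saddleShift]

lemma saddleShift₁_zero (lam : ℝ) : saddleShift₁ lam 0 = 0 := by simp [saddleShift₁]

lemma saddleShift₂_zero (lam : ℝ) : saddleShift₂ lam 0 = 0 := by simp [saddleShift₂]

lemma one_add_ofReal_ne_zero (hlam : 0 < lam) : (1 + lam : ℂ) ≠ 0 := by
  exact_mod_cast (by positivity : (1 + lam) ≠ 0)

lemma saddleShift₃_zero (hlam : 0 < lam) : saddleShift₃ lam 0 = 6 := by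
  have h := one_add_ofReal_ne_zero hlam
  simp only [saddleShift₃, Complex.exp_zero, mul_zero, mul_one]
  field_simp

lemma differentiable_saddleShift (hlam : 0 < lam) : Differentiable ℂ (saddleShift lam) :=
  fun t => (hasDerivAt_saddleShift hlam t).differentiableAt

lemma saddleShift_conj (lam : ℝ) (t : ℂ) : saddleShift lam (conj t) = conj (saddleShift lam t) := by
  have h6 : conj (6 : ℂ) = 6 := Complex.conj_ofNat 6
  unfold saddleShift
  simp [← Complex.exp_conj, h6]

/-- `saddleShift lam t = t ^ 3 (1 + O(t))`. -/
lemma exists_saddleShift_factor (hlam : 0 < lam) : ∃ G : ℂ → ℂ, AnalyticAt ℂ G 0 ∧ G 0 = 1 ∧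
    ∀ᶠ t in 𝓝 (0 : ℂ), saddleShift lam t = t ^ 3 * G t := by
  have hd0 (t : ℂ) : HasDerivAt (fun t => saddleShift lam t - t ^ 3)
      (saddleShift₁ lam t - 3 * t ^ 2) t :=
    ((hasDerivAt_saddleShift hlam t).sub (hasDerivAt_pow 3 t)).congr_deriv (by
      unfold saddleShift₁; norm_num)
  have hd1 (t : ℂ) : HasDerivAt (fun t => saddleShift₁ lam t - 3 * t ^ 2)
      (saddleShift₂ lam t - 6 * t) t :=
    ((hasDerivAt_saddleShift₁ hlam t).sub ((hasDerivAt_pow 2 t).const_mul 3)).congr_deriv (by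
      norm_num; ring)
  have hd2 (t : ℂ) : HasDerivAt (fun t => saddleShift₂ lam t - 6 * t)
      (saddleShift₃ lam t - 6) t :=
    ((hasDerivAt_saddleShift₂ lam t).sub ((hasDerivAt_id t).const_mul 6)).congr_deriv (by ring)
  have hi1 : iteratedDeriv 1 (fun t => saddleShift lam t - t ^ 3) =
      fun t => saddleShift₁ lam t - 3 * t ^ 2 := by
    rw [iteratedDeriv_one]; exact funext fun t => (hd0 t).deriv
  have hi2 : iteratedDeriv 2 (fun t => saddleShift lam t - t ^ 3) =
      fun t => saddleShift₂ lam t - 6 * t := by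
    rw [iteratedDeriv_succ, hi1]; exact funext fun t => (hd1 t).deriv
  have hi3 : iteratedDeriv 3 (fun t => saddleShift lam t - t ^ 3) =
      fun t => saddleShift₃ lam t - 6 := by
    rw [iteratedDeriv_succ, hi2]; exact funext fun t => (hd2 t).deriv
  have hdiff : Differentiable ℂ fun t => saddleShift lam t - t ^ 3 :=
    fun t => (hd0 t).differentiableAt
  have han : AnalyticAt ℂ (fun t => saddleShift lam t - t ^ 3) 0 := hdiff.analyticAt 0
  have hord : ((4 : ℕ) : ℕ∞) ≤ analyticOrderAt (fun t => saddleShift lam t - t ^ 3) 0 := by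
    rw [natCast_le_analyticOrderAt_iff_iteratedDeriv_eq_zero han]
    intro i hi
    interval_cases i
    · simp [saddleShift_zero]
    · simp [hi1, saddleShift₁_zero]
    · simp [hi2, saddleShift₂_zero]
    · simp [hi3, saddleShift₃_zero hlam]
  obtain ⟨g, hg, hfg⟩ := (natCast_le_analyticOrderAt han).1 hord
  refine ⟨fun t => 1 + t * g t, by fun_prop, by simp, ?_⟩
  filter_upwards [hfg] with t ht
  rw [sub_zero, smul_eq_mul] at ht
  linear_combination ht

/-- The analytic solution `T` of `saddleShift lam (T z) = z ^ 3` with `T z = z + O(z ^ 2)`. -/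
lemma exists_cubic_inverse (hlam : 0 < lam) : ∃ T : ℂ → ℂ, AnalyticAt ℂ T 0 ∧ T 0 = 0 ∧
    deriv T 0 = 1 ∧ (∀ᶠ z in 𝓝 (0 : ℂ), saddleShift lam (T z) = z ^ 3) ∧
    ∀ᶠ z in 𝓝 (0 : ℂ), conj (T (conj z)) = T z := by
  obtain ⟨G, hG, hG0, hfac⟩ := exists_saddleShift_factor hlam
  -- An analytic cube root of `saddleShift lam`, single valued since `G` is near `1`. Its inverse
  -- function is the required `T`.
  set φ : ℂ → ℂ := fun t => t * G t ^ (1 / 3 : ℂ) with hφ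
  have hGs : G 0 ∈ Complex.slitPlane := by rw [hG0]; exact Complex.one_mem_slitPlane
  have hφan : AnalyticAt ℂ φ 0 := analyticAt_id.mul (hG.cpow analyticAt_const hGs)
  have hφ0 : φ 0 = 0 := by simp [hφ]
  have hφ1 : deriv φ 0 = 1 := by
    have hd : HasDerivAt φ (1 * G 0 ^ (1 / 3 : ℂ) + 0 * deriv (fun t => G t ^ (1 / 3 : ℂ)) 0) 0 :=
      (hasDerivAt_id (0 : ℂ)).mul (hG.cpow analyticAt_const hGs).differentiableAt.hasDerivAt
    rw [hd.deriv, hG0]; simp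
  have hφ3 (t : ℂ) : φ t ^ 3 = t ^ 3 * G t := by
    rw [hφ]
    simp only
    rw [mul_pow, ← Complex.cpow_nat_mul]
    norm_num
  have hne : deriv φ 0 ≠ 0 := by rw [hφ1]; exact one_ne_zero
  set T := hφan.hasStrictDerivAt.localInverse _ _ _ hne with hT
  have hTan : AnalyticAt ℂ T 0 := by
    have := hφan.analyticAt_localInverse hne
    rwa [hφ0] at this
  have hleft : ∀ᶠ t in 𝓝 (0 : ℂ), T (φ t) = t :=
    HasStrictDerivAt.eventually_left_inverse hφan.hasStrictDerivAt hne
  have hright : ∀ᶠ z in 𝓝 (0 : ℂ), φ (T z) = z := by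
    have := HasStrictDerivAt.eventually_right_inverse hφan.hasStrictDerivAt hne
    rwa [hφ0] at this
  have hT0 : T 0 = 0 := by simpa [hφ0] using hleft.self_of_nhds
  have hT1 : deriv T 0 = 1 := by
    have := (HasStrictDerivAt.to_localInverse hφan.hasStrictDerivAt hne).hasDerivAt.deriv
    rw [hφ0] at this
    exact this.trans (by rw [hφ1, inv_one])
  have hTt : Tendsto T (𝓝 0) (𝓝 0) := by simpa [hT0] using hTan.continuousAt.tendsto
  have hconj0 : Tendsto (conj : ℂ → ℂ) (𝓝 0) (𝓝 0) := by
    simpa using Complex.continuous_conj.tendsto 0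
  -- `G` inherits conjugation symmetry from `saddleShift`, and the principal cube root respects it
  -- off the cut. Local injectivity of `φ` then transfers the symmetry to `T`.
  have hφconj : ∀ᶠ t in 𝓝 (0 : ℂ), φ (conj t) = conj (φ t) := by
    have hs : ∀ᶠ t in 𝓝 (0 : ℂ), G t ∈ Complex.slitPlane :=
      hG.continuousAt.eventually (Complex.isOpen_slitPlane.mem_nhds hGs)
    filter_upwards [hfac, hconj0.eventually hfac, hs] with t h1 h2 h3
    rcases eq_or_ne t 0 with rfl | ht
    · simp [hφ]
    · have hGc : G (conj t) = conj (G t) := by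
        rw [saddleShift_conj, h1, map_mul, map_pow] at h2
        exact (mul_left_cancel₀ (pow_ne_zero 3 (by simpa using ht)) h2).symm
      rw [hφ]
      simp only
      rw [hGc, map_mul, Complex.conj_cpow _ _ (Complex.mem_slitPlane_iff_arg.1 h3).1]
      have h6 : conj (3 : ℂ) = 3 := Complex.conj_ofNat 3
      simp [h6]
  refine ⟨T, hTan, hT0, hT1, ?_, ?_⟩
  · filter_upwards [hright, hTt.eventually hfac] with z h1 h2
    rw [h2, ← hφ3, h1]
  · have hstar : Tendsto (fun z => conj (T (conj z))) (𝓝 0) (𝓝 0) :=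
      hconj0.comp (hTt.comp hconj0)
    filter_upwards [hstar.eventually hleft, (hTt.comp hconj0).eventually hφconj,
      hconj0.eventually hright] with z h1 h2 h3
    simp only [Function.comp_apply] at h2
    rw [h2, h3, Complex.conj_conj] at h1
    exact h1.symm

end LocalInverse

/-- Here `b` stands for the Taylor coefficients of `T'`, and `p`, `q`, `r` for those of `K'`, `K''`,
`K'''` composed with `T`. `h1` is the derivative of `K(T(z)) = z³`, `h2` to `h4` are the chain rule.
At stage `n`, `h4` gives `r n` from known data, and `h1 (n+2)`, `h2 (n+1)`, `h3 n` are linear in the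
unknowns `b n`, `q (n+1)`, `p (n+2)`. -/
lemma cubic_inverse_coeff_recursion {l : ℂ} {b p q r : ℕ → ℂ}
    (hb0 : b 0 = 1) (hp0 : p 0 = 0) (hq0 : q 0 = 0) (hr0 : r 0 = 6)
    (h1 : ∀ n, ∑ i ∈ Finset.range (n + 1), p i * b (n - i) = if n = 2 then 3 else 0)
    (h2 : ∀ n : ℕ, (n + 1) * p (n + 1) = ∑ i ∈ Finset.range (n + 1), q i * b (n - i))
    (h3 : ∀ n : ℕ, (n + 1) * q (n + 1) = ∑ i ∈ Finset.range (n + 1), r i * b (n - i))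
    (h4 : ∀ n : ℕ, (n + 1) * r (n + 1) =
      ∑ i ∈ Finset.range (n + 1), ((1 - l) * r i + l * q i) * b (n - i)) :
    b 1 = (-1 + l) / 6 ∧
      b 2 = (1 - 6 * l + l ^ 2) / 80 ∧
      b 3 = (5 + 93 * l - 93 * l ^ 2 - 5 * l ^ 3) / 6480 ∧
      b 4 = (-277 - 836 * l + 6114 * l ^ 2 - 836 * l ^ 3 - 277 * l ^ 4) / 1088640 ∧
      b 5 = (1 - 61 * l - 254 * l ^ 2 + 254 * l ^ 3 + 61 * l ^ 4 - l ^ 5) / 268800 ∧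
      b 6 = (959 + 7098 * l - 2031 * l ^ 2 - 58708 * l ^ 3 - 2031 * l ^ 4 + 7098 * l ^ 5 +
        959 * l ^ 6) / 167961600 := by
  have hp1 : p 1 = 0 := by simpa [hq0] using h2 0
  have hq1 : q 1 = 6 := by simpa [hr0, hb0] using h3 0
  have hp2 : p 2 = 3 := by simpa [Finset.sum_range_succ, hp0, hp1, hb0] using h1 2
  have hr1 : r 1 = 6 - 6 * l := by
    have e := h4 0
    norm_num [Finset.sum_range_succ, hb0, hp0, hp1, hp2, hq0, hq1, hr0] at e
    linear_combination e
  have e1 := h1 3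
  have e2 := h2 2
  have e3 := h3 1
  norm_num [Finset.sum_range_succ, hb0, hp0, hp1, hp2, hq0, hq1, hr0, hr1] at e1 e2 e3
  -- Eliminating `q (n+1)` and `p (n+2)` leaves `b n` with coefficient `3 + 6/(n+1) = 3(n+3)/(n+1)`.
  -- This explains the weights `1/(n+2)` and `1/((n+1)(n+2))` and the outer factor `(n+1)/(3(n+3))`
  -- here and at every later stage.
  have hb1 : b 1 = (-1 + l) / 6 := by
    linear_combination (1 / 6) * (e1 - e2 / 3 - e3 / 6)
  have hq2 : q 2 = (5 - 5 * l) / 2 := by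
    linear_combination e3 / 2 + 6 / 2 * hb1
  have hp3 : p 3 = (1 - l) / 2 := by
    linear_combination e1 - 3 * hb1
  clear e1 e2 e3
  have hr2 : r 2 = (5 - 4 * l + 5 * l ^ 2) / 2 := by
    have e := h4 1
    norm_num [Finset.sum_range_succ, hb0, hp0, hp1, hp2, hq0, hq1, hr0, hr1, hb1, hq2, hp3] at e
    linear_combination e / 2
  have e1 := h1 4
  have e2 := h2 3
  have e3 := h3 2
  norm_num [Finset.sum_range_succ, hb0, hp0, hp1, hp2, hq0, hq1, hr0, hr1, hb1, hq2, hp3, hr2]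
      at e1 e2 e3
  have hb2 : b 2 = (1 - 6 * l + l ^ 2) / 80 := by
    linear_combination (1 / 5) * (e1 - e2 / 4 - e3 / 12)
  have hq3 : q 3 = (21 - 6 * l + 21 * l ^ 2) / 40 := by
    linear_combination e3 / 3 + 6 / 3 * hb2
  have hp4 : p 4 = (11 + 14 * l + 11 * l ^ 2) / 240 := by
    linear_combination e1 - 3 * hb2
  clear e1 e2 e3
  have hr3 : r 3 = (21 - 7 * l + 7 * l ^ 2 - 21 * l ^ 3) / 40 := by
    have e := h4 2
    norm_num [Finset.sum_range_succ, hb0, hp0, hp1, hp2, hq0, hq1, hr0, hr1, hb1, hq2, hp3,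
        hr2, hb2, hq3, hp4] at e
    linear_combination e / 3
  have e1 := h1 5
  have e2 := h2 4
  have e3 := h3 3
  norm_num [Finset.sum_range_succ, hb0, hp0, hp1, hp2, hq0, hq1, hr0, hr1, hb1, hq2, hp3, hr2,
      hb2, hq3, hp4, hr3] at e1 e2 e3
  have hb3 : b 3 = (5 + 93 * l - 93 * l ^ 2 - 5 * l ^ 3) / 6480 := by
    linear_combination (2 / 9) * (e1 - e2 / 5 - e3 / 20)
  have hq4 : q 4 = (203 + 147 * l - 147 * l ^ 2 - 203 * l ^ 3) / 4320 := by
    linear_combination e3 / 4 + 6 / 4 * hb3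
  have hp5 : p 5 = (-1 + 3 * l - 3 * l ^ 2 + l ^ 3) / 1080 := by
    linear_combination e1 - 3 * hb3
  clear e1 e2 e3
  have hr4 : r 4 = (203 + 142 * l - 42 * l ^ 2 + 142 * l ^ 3 + 203 * l ^ 4) / 4320 := by
    have e := h4 3
    norm_num [Finset.sum_range_succ, hb0, hp0, hp1, hp2, hq0, hq1, hr0, hr1, hb1, hq2, hp3,
        hr2, hb2, hq3, hp4, hr3, hb3, hq4, hp5] at e
    linear_combination e / 4
  have e1 := h1 6
  have e2 := h2 5
  have e3 := h3 4
  norm_num [Finset.sum_range_succ, hb0, hp0, hp1, hp2, hq0, hq1, hr0, hr1, hb1, hq2, hp3, hr2,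
      hb2, hq3, hp4, hr3, hb3, hq4, hp5, hr4] at e1 e2 e3
  have hb4 : b 4 = (-277 - 836 * l + 6114 * l ^ 2 - 836 * l ^ 3 - 277 * l ^ 4) / 1088640 := by
    linear_combination (5 / 21) * (e1 - e2 / 6 - e3 / 30)
  have hq5 : q 5 = (-1117 + 2524 * l + 1074 * l ^ 2 + 2524 * l ^ 3 - 1117 * l ^ 4) / 907200 := by
    linear_combination e3 / 5 + 6 / 5 * hb4
  have hp6 : p 6 = (-47 - 156 * l - 26 * l ^ 2 - 156 * l ^ 3 - 47 * l ^ 4) / 134400 := by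
    linear_combination e1 - 3 * hb4
  clear e1 e2 e3
  have hr5 : r 5 = (-1117 + 2801 * l + 1070 * l ^ 2 - 1070 * l ^ 3 - 2801 * l ^ 4 + 1117 * l ^
      5) / 907200 := by
    have e := h4 4
    norm_num [Finset.sum_range_succ, hb0, hp0, hp1, hp2, hq0, hq1, hr0, hr1, hb1, hq2, hp3,
        hr2, hb2, hq3, hp4, hr3, hb3, hq4, hp5, hr4, hb4, hq5, hp6] at e
    linear_combination e / 5
  have e1 := h1 7
  have e2 := h2 6
  have e3 := h3 5
  norm_num [Finset.sum_range_succ, hb0, hp0, hp1, hp2, hq0, hq1, hr0, hr1, hb1, hq2, hp3, hr2,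
      hb2, hq3, hp4, hr3, hb3, hq4, hp5, hr4, hb4, hq5, hp6, hr5] at e1 e2 e3
  have hb5 : b 5 = (1 - 61 * l - 254 * l ^ 2 + 254 * l ^ 3 + 61 * l ^ 4 - l ^ 5) / 268800 := by
    linear_combination (1 / 4) * (e1 - e2 / 7 - e3 / 42)
  have hq6 : q 6 = (-31 - 93 * l + 2 * l ^ 2 - 2 * l ^ 3 + 93 * l ^ 4 + 31 * l ^ 5) / 89600 := by
    linear_combination e3 / 6 + 6 / 6 * hb5
  have hp7 : p 7 = (37 - 5 * l - 170 * l ^ 2 + 170 * l ^ 3 + 5 * l ^ 4 - 37 * l ^ 5) / 1088640 := by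
    linear_combination e1 - 3 * hb5
  clear e1 e2 e3
  have hr6 : r 6 = (-93 - 280 * l - 27 * l ^ 2 - 64 * l ^ 3 - 27 * l ^ 4 - 280 * l ^ 5 - 93 *
      l ^ 6) / 268800 := by
    have e := h4 5
    norm_num [Finset.sum_range_succ, hb0, hp0, hp1, hp2, hq0, hq1, hr0, hr1, hb1, hq2, hp3,
        hr2, hb2, hq3, hp4, hr3, hb3, hq4, hp5, hr4, hb4, hq5, hp6, hr5, hb5, hq6, hp7] at e
    linear_combination e / 6
  have e1 := h1 8
  have e2 := h2 7
  have e3 := h3 6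
  norm_num [Finset.sum_range_succ, hb0, hp0, hp1, hp2, hq0, hq1, hr0, hr1, hb1, hq2, hp3, hr2,
      hb2, hq3, hp4, hr3, hb3, hq4, hp5, hr4, hb4, hq5, hp6, hr5, hb5, hq6, hp7, hr6] at e1 e2 e3
  have hb6 : b 6 = (959 + 7098 * l - 2031 * l ^ 2 - 58708 * l ^ 3 - 2031 * l ^ 4 + 7098 * l ^
      5 + 959 * l ^ 6) / 167961600 := by
    linear_combination (7 / 27) * (e1 - e2 / 8 - e3 / 56)
  exact ⟨hb1, hb2, hb3, hb4, hb5, hb6⟩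

/-! ### Calculus of Taylor coefficients at the origin. -/

section TaylorCoeff

open scoped ComplexConjugate

/-- The Taylor coefficients at the origin. -/
def taylorCoeff (f : ℂ → ℂ) (n : ℕ) : ℂ := iteratedDeriv n f 0 / n.factorial

lemma taylorCoeff_congr {f g : ℂ → ℂ} (h : f =ᶠ[𝓝 0] g) (n : ℕ) :
    taylorCoeff f n = taylorCoeff g n := by
  rw [taylorCoeff, taylorCoeff, h.iteratedDeriv_eq]

lemma taylorCoeff_deriv (f : ℂ → ℂ) (n : ℕ) :
    taylorCoeff (deriv f) n = (n + 1) * taylorCoeff f (n + 1) := by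
  have h1 : (n : ℂ) + 1 ≠ 0 := by exact_mod_cast n.succ_ne_zero
  have h2 : (n.factorial : ℂ) ≠ 0 := by exact_mod_cast n.factorial_ne_zero
  rw [taylorCoeff, taylorCoeff, iteratedDeriv_succ', Nat.factorial_succ]
  push_cast
  field_simp

lemma taylorCoeff_mul {f g : ℂ → ℂ} (hf : AnalyticAt ℂ f 0) (hg : AnalyticAt ℂ g 0) (n : ℕ) :
    taylorCoeff (f * g) n =
      ∑ i ∈ Finset.range (n + 1), taylorCoeff f i * taylorCoeff g (n - i) := by
  rw [taylorCoeff, iteratedDeriv_mul hf.contDiffAt hg.contDiffAt, Finset.sum_div]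
  refine Finset.sum_congr rfl fun i hi => ?_
  have hin : i ≤ n := Nat.lt_succ_iff.1 (Finset.mem_range.1 hi)
  have h1 : (i.factorial : ℂ) ≠ 0 := by exact_mod_cast i.factorial_ne_zero
  have h2 : ((n - i).factorial : ℂ) ≠ 0 := by exact_mod_cast (n - i).factorial_ne_zero
  have h3 : (n.factorial : ℂ) ≠ 0 := by exact_mod_cast n.factorial_ne_zero
  have h4 : (n.choose i : ℂ) * i.factorial * (n - i).factorial = n.factorial := by
    exact_mod_cast Nat.choose_mul_factorial_mul_factorial hin
  rw [taylorCoeff, taylorCoeff]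
  field_simp
  linear_combination (iteratedDeriv i f 0 * iteratedDeriv (n - i) g 0) * h4

lemma taylorCoeff_const_mul_pow (c : ℂ) (m n : ℕ) :
    taylorCoeff (fun z => c * z ^ m) n = if n = m then c else 0 := by
  rw [taylorCoeff, iteratedDeriv_const_mul_field, iteratedDeriv_fun_pow_zero]
  split_ifs with h
  · have h3 : (m.factorial : ℂ) ≠ 0 := by exact_mod_cast m.factorial_ne_zero
    rw [h]; field_simp
  · simp

lemma iteratedDeriv_conj_conj (f : ℂ → ℂ) (n : ℕ) :
    iteratedDeriv n (conj ∘ f ∘ conj) = conj ∘ iteratedDeriv n f ∘ conj := by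
  induction n with
  | zero => simp
  | succ n ih => rw [iteratedDeriv_succ, ih, iteratedDeriv_succ, deriv_conj_conj]

lemma conj_taylorCoeff {f : ℂ → ℂ} (h : ∀ᶠ z in 𝓝 (0 : ℂ), conj (f (conj z)) = f z) (n : ℕ) :
    conj (taylorCoeff f n) = taylorCoeff f n := by
  have h' : conj ∘ f ∘ conj =ᶠ[𝓝 0] f := h
  have h1 := h'.iteratedDeriv_eq n
  rw [iteratedDeriv_conj_conj] at h1
  simp only [Function.comp_apply, map_zero] at h1
  rw [taylorCoeff, map_div₀, h1, map_natCast]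

lemma eventually_hasSum_taylorCoeff {f : ℂ → ℂ} (hf : AnalyticAt ℂ f 0) :
    ∀ᶠ z in 𝓝 (0 : ℂ), HasSum (fun n => taylorCoeff f n * z ^ n) (f z) := by
  obtain ⟨r, hr, hball⟩ := Metric.eventually_nhds_iff_ball.1 hf.eventually_analyticAt
  have hd : DifferentiableOn ℂ f (Metric.ball 0 r) := fun z hz =>
    (hball z hz).differentiableAt.differentiableWithinAt
  filter_upwards [Metric.ball_mem_nhds 0 hr] with z hz
  refine (Complex.hasSum_taylorSeries_on_ball hd hz).congr_fun fun n => ?_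
  rw [taylorCoeff, sub_zero, smul_eq_mul, smul_eq_mul]
  ring

end TaylorCoeff

/-! ### The upper branch U and its coefficients. -/

section UpperBranch

open scoped ComplexConjugate

variable {lam a : ℝ}

lemma taylorCoeff_cubic_inverse (hlam : 0 < lam) {T : ℂ → ℂ} (hT : AnalyticAt ℂ T 0)
    (hT0 : T 0 = 0) (hT1 : deriv T 0 = 1)
    (hTeq : ∀ᶠ z in 𝓝 (0 : ℂ), saddleShift lam (T z) = z ^ 3) :
    let b := taylorCoeff (deriv T)
    b 0 = 1 ∧ b 1 = (-1 + lam) / 6 ∧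
      b 2 = (1 - 6 * lam + lam ^ 2) / 80 ∧
      b 3 = (5 + 93 * lam - 93 * lam ^ 2 - 5 * lam ^ 3) / 6480 ∧
      b 4 = (-277 - 836 * lam + 6114 * lam ^ 2 - 836 * lam ^ 3 - 277 * lam ^ 4) / 1088640 ∧
      b 5 = (1 - 61 * lam - 254 * lam ^ 2 + 254 * lam ^ 3 + 61 * lam ^ 4 - lam ^ 5) / 268800 ∧
      b 6 = (959 + 7098 * lam - 2031 * lam ^ 2 - 58708 * lam ^ 3 - 2031 * lam ^ 4 +
        7098 * lam ^ 5 + 959 * lam ^ 6) / 167961600 := by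
  intro b
  have hTd : ∀ᶠ z in 𝓝 (0 : ℂ), DifferentiableAt ℂ T z :=
    hT.eventually_analyticAt.mono fun z hz => hz.differentiableAt
  have hdT : AnalyticAt ℂ (deriv T) 0 := hT.deriv
  have hcomp {f g : ℂ → ℂ} (hf : ∀ t, HasDerivAt f (g t) t) :
      deriv (f ∘ T) =ᶠ[𝓝 0] (g ∘ T) * deriv T := by
    filter_upwards [hTd] with z hz
    exact ((hf (T z)).comp z hz.hasDerivAt).deriv
  have han {f g : ℂ → ℂ} (hf : ∀ t, HasDerivAt f (g t) t) : AnalyticAt ℂ (f ∘ T) 0 :=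
    ((Differentiable.analyticAt fun t => (hf t).differentiableAt) (T 0)).comp hT
  have a1 := han (hasDerivAt_saddleShift₁ hlam)
  have a2 := han (hasDerivAt_saddleShift₂ lam)
  have a3 := han (hasDerivAt_saddleShift₃ lam)
  have h1 (n : ℕ) : ∑ i ∈ Finset.range (n + 1), taylorCoeff (saddleShift₁ lam ∘ T) i * b (n - i) =
      if n = 2 then 3 else 0 := by
    rw [← taylorCoeff_mul a1 hdT, ← taylorCoeff_const_mul_pow]
    refine taylorCoeff_congr ?_ n
    have h : saddleShift lam ∘ T =ᶠ[𝓝 0] fun z => z ^ 3 := hTeq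
    refine (hcomp (hasDerivAt_saddleShift hlam)).symm.trans (h.deriv.trans ?_)
    exact Eventually.of_forall fun z => by simp
  have h2 (n : ℕ) : (n + 1) * taylorCoeff (saddleShift₁ lam ∘ T) (n + 1) =
      ∑ i ∈ Finset.range (n + 1), taylorCoeff (saddleShift₂ lam ∘ T) i * b (n - i) := by
    rw [← taylorCoeff_deriv, ← taylorCoeff_mul a2 hdT]
    exact taylorCoeff_congr (hcomp (hasDerivAt_saddleShift₁ hlam)) n
  have h3 (n : ℕ) : (n + 1) * taylorCoeff (saddleShift₂ lam ∘ T) (n + 1) =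
      ∑ i ∈ Finset.range (n + 1), taylorCoeff (saddleShift₃ lam ∘ T) i * b (n - i) := by
    rw [← taylorCoeff_deriv, ← taylorCoeff_mul a3 hdT]
    exact taylorCoeff_congr (hcomp (hasDerivAt_saddleShift₂ lam)) n
  have c2 : AnalyticAt ℂ (fun z => (lam : ℂ) * (saddleShift₂ lam ∘ T) z) 0 :=
    analyticAt_const.mul a2
  have c3 : AnalyticAt ℂ (fun z => (1 - (lam : ℂ)) * (saddleShift₃ lam ∘ T) z) 0 :=
    analyticAt_const.mul a3
  have h4 (n : ℕ) : (n + 1) * taylorCoeff (saddleShift₃ lam ∘ T) (n + 1) =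
      ∑ i ∈ Finset.range (n + 1), ((1 - lam) * taylorCoeff (saddleShift₃ lam ∘ T) i +
        lam * taylorCoeff (saddleShift₂ lam ∘ T) i) * b (n - i) := by
    have hlin (i : ℕ) : (1 - lam) * taylorCoeff (saddleShift₃ lam ∘ T) i +
        lam * taylorCoeff (saddleShift₂ lam ∘ T) i =
        taylorCoeff ((fun t => (1 - lam) * saddleShift₃ lam t + lam * saddleShift₂ lam t) ∘ T)
          i := by
      have e : (fun t => (1 - lam) * saddleShift₃ lam t + lam * saddleShift₂ lam t) ∘ T =
          (fun z => (1 - (lam : ℂ)) * (saddleShift₃ lam ∘ T) z) +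
            fun z => (lam : ℂ) * (saddleShift₂ lam ∘ T) z := rfl
      rw [taylorCoeff, taylorCoeff, taylorCoeff, e,
        iteratedDeriv_add c3.contDiffAt c2.contDiffAt,
        iteratedDeriv_const_mul_field, iteratedDeriv_const_mul_field]
      ring
    simp_rw [hlin]
    rw [← taylorCoeff_deriv, ← taylorCoeff_mul _ hdT]
    · exact taylorCoeff_congr (hcomp (hasDerivAt_saddleShift₃ lam)) n
    · exact c3.add c2
  have c0 (f : ℂ → ℂ) : taylorCoeff f 0 = f 0 := by simp [taylorCoeff]
  have hb0 : b 0 = 1 := (c0 _).trans hT1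
  refine ⟨hb0, cubic_inverse_coeff_recursion hb0 ?_ ?_ ?_ h1 h2 h3 h4⟩
  · rw [c0, Function.comp_apply, hT0, saddleShift₁_zero]
  · rw [c0, Function.comp_apply, hT0, saddleShift₂_zero]
  · rw [c0, Function.comp_apply, hT0, saddleShift₃_zero hlam]

lemma two_rpow_div_cube (hlam : 0 < lam) :
    ((2 : ℝ) ^ (2 / 3 : ℝ) / bigH lam ^ (1 / 3 : ℝ)) ^ 3 = 4 / bigH lam := by
  rw [div_pow, ← Real.rpow_mul_natCast (by norm_num), ← Real.rpow_mul_natCast (bigH_pos hlam).le]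
  norm_num

lemma cexp_pi_third_cube : Complex.exp ((Real.pi : ℂ) * Complex.I / 3) ^ 3 = -1 := by
  rw [← Complex.exp_nat_mul, ← Complex.exp_pi_mul_I]
  congr 1; push_cast; ring

/-- The scale is dictated by `(H/12) κ³ = -1/3`, and among the three cube roots of `-4/H` the one of
argument `π/3` gives the upper branch. -/
lemma isUpperBranch_of_cubic_inverse (hlam : 0 < lam)
    (ha : a = (1 + lam) / 2 * lam ^ ((1 - lam) / (1 + lam))) {T : ℂ → ℂ}
    (hT : AnalyticAt ℂ T 0) (hT0 : T 0 = 0) (hT1 : deriv T 0 = 1)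
    (hTeq : ∀ᶠ z in 𝓝 (0 : ℂ), saddleShift lam (T z) = z ^ 3) :
    IsUpperBranch lam a fun w => doubleSaddle lam + T
      ((((2 : ℝ) ^ (2 / 3 : ℝ) / bigH lam ^ (1 / 3 : ℝ) : ℝ) : ℂ) *
        Complex.exp ((Real.pi : ℂ) * Complex.I / 3) * w) := by
  set κ : ℂ := (((2 : ℝ) ^ (2 / 3 : ℝ) / bigH lam ^ (1 / 3 : ℝ) : ℝ) : ℂ) *
        Complex.exp ((Real.pi : ℂ) * Complex.I / 3) with hκ
  have hκ3 : bigH lam * κ ^ 3 = -4 := by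
    have h : (bigH lam : ℂ) ≠ 0 := by exact_mod_cast (bigH_pos hlam).ne'
    rw [hκ, mul_pow, cexp_pi_third_cube, ← Complex.ofReal_pow, two_rpow_div_cube hlam]
    push_cast
    field_simp
  have hlin : Tendsto (fun w : ℂ => κ * w) (𝓝 0) (𝓝 0) := by
    simpa using (continuous_const_mul κ).tendsto 0
  refine ⟨?_, by simp [hT0], ?_, ?_⟩
  · refine analyticAt_const.add (AnalyticAt.comp ?_ (analyticAt_const.mul analyticAt_id))
    simpa using hT
  · have h0 : HasDerivAt T 1 (κ * 0) := by
      rw [mul_zero, ← hT1]; exact hT.differentiableAt.hasDerivAt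
    have := (h0.comp (0 : ℂ) ((hasDerivAt_id (0 : ℂ)).const_mul κ)).const_add
      (doubleSaddle lam : ℂ)
    rw [one_mul, mul_one] at this
    exact this.deriv
  · filter_upwards [hlin.eventually hTeq] with w hw
    rw [phase_doubleSaddle_add hlam ha, hw]
    linear_combination (w ^ 3 / 12) * hκ3

lemma exists_saddleCoeff (hlam : 0 < lam)
    (ha : a = (1 + lam) / 2 * lam ^ ((1 - lam) / (1 + lam))) :
    ∃ B : ℕ → ℝ, IsSaddleCoeff lam a B ∧
      B 0 = 1 ∧
      B 1 = (lam - 1) / ((2 : ℝ) ^ (1 / 3 : ℝ) * 3) ∧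
      B 2 = (1 - 6 * lam + lam ^ 2) / ((2 : ℝ) ^ (2 / 3 : ℝ) * 20) ∧
      B 3 = (5 + 93 * lam - 93 * lam ^ 2 - 5 * lam ^ 3) / 1620 ∧
      B 4 = -(277 + 836 * lam - 6114 * lam ^ 2 + 836 * lam ^ 3 + 277 * lam ^ 4) /
        ((2 : ℝ) ^ (1 / 3 : ℝ) * 136080) ∧
      B 5 = (1 - 61 * lam - 254 * lam ^ 2 + 254 * lam ^ 3 + 61 * lam ^ 4 - lam ^ 5) /
        ((2 : ℝ) ^ (2 / 3 : ℝ) * 16800) ∧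
      B 6 = (959 + 7098 * lam - 2031 * lam ^ 2 - 58708 * lam ^ 3 - 2031 * lam ^ 4 +
        7098 * lam ^ 5 + 959 * lam ^ 6) / 10497600 := by
  obtain ⟨T, hT, hT0, hT1, hTeq, hTconj⟩ := exists_cubic_inverse hlam
  have hvals := taylorCoeff_cubic_inverse hlam hT hT0 hT1 hTeq
  set b := taylorCoeff (deriv T) with hb
  have hreal (n : ℕ) : ((b n).re : ℂ) = b n := by
    refine Complex.conj_eq_iff_re.1 (conj_taylorCoeff ?_ n)
    have h : conj ∘ T ∘ conj =ᶠ[𝓝 0] T := hTconj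
    have h' := h.deriv
    rw [deriv_conj_conj] at h'
    exact h'
  set d : ℝ := (2 : ℝ) ^ (1 / 3 : ℝ) with hd
  have hd0 : 0 < d := by positivity
  have hd3 : d ^ 3 = 2 := by
    rw [hd, ← Real.rpow_mul_natCast (by norm_num)]; norm_num
  have hd2 : (2 : ℝ) ^ (2 / 3 : ℝ) = d ^ 2 := by
    rw [hd, ← Real.rpow_mul_natCast (by norm_num)]; norm_num
  -- Since `U'(w) = κ T'(κw)`, the `k`-th coefficient carries `κ^k`. Its factors `H^(-k/3)` and
  -- `e^(πik/3)` are already displayed in the expansion, so only `2^(2k/3)` goes into `B k`.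
  refine ⟨fun k => (d ^ 2) ^ k * (b k).re, ⟨_, isUpperBranch_of_cubic_inverse hlam ha hT hT0 hT1
    hTeq, ?_⟩, ?_⟩
  · rw [hd2]
    set κ : ℝ := d ^ 2 / bigH lam ^ (1 / 3 : ℝ) with hκ
    set ω : ℂ := Complex.exp ((Real.pi : ℂ) * Complex.I / 3) with hω
    have hlin : Tendsto (fun w : ℂ => (κ : ℂ) * ω * w) (𝓝 0) (𝓝 0) := by
      simpa using (continuous_const_mul ((κ : ℂ) * ω)).tendsto 0
    filter_upwards [hlin.eventually (eventually_hasSum_taylorCoeff hT.deriv)] with w hw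
    rw [deriv_const_add, deriv_comp_mul_left, smul_eq_mul]
    refine (hw.mul_left ((κ : ℂ) * ω)).congr_fun fun k => ?_
    have h1 : Complex.exp ((Real.pi : ℂ) * Complex.I * ((k : ℂ) + 1) / 3) = ω * ω ^ k := by
      rw [hω, ← Complex.exp_nat_mul, ← Complex.exp_add]
      congr 1; ring
    have h2 : (d ^ 2) ^ k * (b k).re / bigH lam ^ ((k : ℝ) / 3) = κ ^ k * (b k).re := by
      rw [hκ, div_pow, ← Real.rpow_mul_natCast (bigH_pos hlam).le,
        show 1 / 3 * (k : ℝ) = (k : ℝ) / 3 by ring]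
      ring
    rw [h1, h2, Complex.ofReal_mul, hreal]
    push_cast
    ring
  · rw [hd2]
    obtain ⟨h0, h1, h2, h3, h4, h5, h6⟩ := hvals
    have hre {z : ℂ} {y : ℝ} (h : z = y) : z.re = y := by rw [h, Complex.ofReal_re]
    have e0 := hre (z := b 0) (y := 1) (by rw [h0]; push_cast; rfl)
    have e1 := hre (z := b 1) (y := (-1 + lam) / 6) (by rw [h1]; push_cast; rfl)
    have e2 := hre (z := b 2) (y := (1 - 6 * lam + lam ^ 2) / 80) (by rw [h2]; push_cast; rfl)
    have e3 := hre (z := b 3) (y := (5 + 93 * lam - 93 * lam ^ 2 - 5 * lam ^ 3) / 6480)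
      (by rw [h3]; push_cast; rfl)
    have e4 := hre (z := b 4)
      (y := (-277 - 836 * lam + 6114 * lam ^ 2 - 836 * lam ^ 3 - 277 * lam ^ 4) / 1088640)
      (by rw [h4]; push_cast; rfl)
    have e5 := hre (z := b 5)
      (y := (1 - 61 * lam - 254 * lam ^ 2 + 254 * lam ^ 3 + 61 * lam ^ 4 - lam ^ 5) / 268800)
      (by rw [h5]; push_cast; rfl)
    have e6 := hre (z := b 6)
      (y := (959 + 7098 * lam - 2031 * lam ^ 2 - 58708 * lam ^ 3 - 2031 * lam ^ 4 +
      7098 * lam ^ 5 + 959 * lam ^ 6) / 167961600) (by rw [h6]; push_cast; rfl)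
    have p2 : (d ^ 2) ^ 2 = 2 * d := by linear_combination d * hd3
    have p3 : (d ^ 2) ^ 3 = 4 := by linear_combination (d ^ 3 + 2) * hd3
    have p4 : (d ^ 2) ^ 4 = 4 * d ^ 2 := by linear_combination d ^ 2 * p3
    have p5 : (d ^ 2) ^ 5 = 8 * d := by linear_combination d ^ 4 * p3 + 4 * d * hd3
    have p6 : (d ^ 2) ^ 6 = 16 := by linear_combination ((d ^ 2) ^ 3 + 4) * p3
    simp only [e0, e1, e2, e3, e4, e5, e6, p2, p3, p4, p5, p6, pow_zero, pow_one, mul_one]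
    refine ⟨trivial, ?_, ?_, ?_, ?_, ?_, ?_⟩
    · rw [eq_div_iff (by positivity)]; linear_combination ((lam - 1) / 2) * hd3
    · rw [eq_div_iff (by positivity)]; linear_combination ((1 - 6 * lam + lam ^ 2) / 2) * hd3
    · ring
    · rw [eq_div_iff (by positivity)]
      linear_combination (-(277 + 836 * lam - 6114 * lam ^ 2 + 836 * lam ^ 3 + 277 * lam ^ 4) / 2)
        * hd3
    · rw [eq_div_iff (by positivity)]
      linear_combination ((1 - 61 * lam - 254 * lam ^ 2 + 254 * lam ^ 3 + 61 * lam ^ 4 - lam ^ 5)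
        / 2) * hd3
    · ring

end UpperBranch

/-! ### Watson's lemma for a cubic exponent. -/

section CubicWatson

open MeasureTheory

/-- The moment `∫₀^∞ w ^ k e ^ (-x w ^ 3 / 3) dw`. -/
def cubicMoment (k : ℕ) (x : ℝ) : ℝ :=
  (x / 3) ^ (-((k : ℝ) + 1) / 3) * (1 / 3) * Real.Gamma (((k : ℝ) + 1) / 3)

lemma cubicMoment_nonneg (k : ℕ) {x : ℝ} (hx : 0 < x) : 0 ≤ cubicMoment k x :=
  mul_nonneg (by positivity) (Real.Gamma_nonneg_of_nonneg (by positivity))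

lemma rpow_mul_exp_eq (k : ℕ) (x w : ℝ) :
    w ^ (k : ℝ) * Real.exp (-(x / 3) * w ^ (3 : ℝ)) = w ^ k * Real.exp (-(x * w ^ 3 / 3)) := by
  rw [Real.rpow_natCast, show (3 : ℝ) = ((3 : ℕ) : ℝ) by norm_num, Real.rpow_natCast]
  congr 2; push_cast; ring

lemma integrableOn_pow_mul_exp_cubic (k : ℕ) {x : ℝ} (hx : 0 < x) :
    IntegrableOn (fun w : ℝ => w ^ k * Real.exp (-(x * w ^ 3 / 3))) (Set.Ioi 0) := by
  have h := integrableOn_rpow_mul_exp_neg_mul_rpow (p := 3) (s := k) (b := x / 3)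
    (by linarith [(Nat.cast_nonneg k : (0 : ℝ) ≤ k)]) (by norm_num) (by positivity)
  simpa only [rpow_mul_exp_eq] using h

lemma integral_pow_mul_exp_cubic (k : ℕ) {x : ℝ} (hx : 0 < x) :
    ∫ w in Set.Ioi (0 : ℝ), w ^ k * Real.exp (-(x * w ^ 3 / 3)) = cubicMoment k x := by
  have h := integral_rpow_mul_exp_neg_mul_rpow (p := 3) (q := k) (b := x / 3)
    (by norm_num) (by linarith [(Nat.cast_nonneg k : (0 : ℝ) ≤ k)]) (by positivity)
  simpa only [rpow_mul_exp_eq, cubicMoment] using h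

/-- For `w > δ` one has `w^k ≤ δ^(-(N-k)) w^N`. The cut-off error is thus absorbed by the moment of
the first neglected term, uniformly in `x > 0`, with no need for exponential smallness. -/
lemma integral_tail_pow_mul_exp_cubic_le {k N : ℕ} (hk : k ≤ N) {δ x : ℝ} (hδ : 0 < δ)
    (hx : 0 < x) : ∫ w in Set.Ioi δ, w ^ k * Real.exp (-(x * w ^ 3 / 3)) ≤
      (δ ^ (N - k))⁻¹ * cubicMoment N x := by
  have hsub : Set.Ioi δ ⊆ Set.Ioi 0 := Set.Ioi_subset_Ioi hδ.le
  have hN := integrableOn_pow_mul_exp_cubic N hx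
  rw [← integral_pow_mul_exp_cubic N hx, ← integral_const_mul]
  refine (setIntegral_mono_on ((integrableOn_pow_mul_exp_cubic k hx).mono_set hsub)
    ((hN.mono_set hsub).const_mul (δ ^ (N - k))⁻¹) measurableSet_Ioi fun w hw => ?_).trans
    (setIntegral_mono_set (hN.const_mul _) ?_ (LE.le.eventuallyLE hsub))
  · have hw0 : 0 < w := hδ.trans hw
    have h1 : w ^ N = w ^ k * w ^ (N - k) := by rw [← pow_add, Nat.add_sub_cancel' hk]
    have h2 : δ ^ (N - k) ≤ w ^ (N - k) := pow_le_pow_left₀ hδ.le (le_of_lt hw) _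
    rw [h1, ← mul_assoc]
    refine mul_le_mul_of_nonneg_right ?_ (Real.exp_pos _).le
    rw [inv_mul_eq_div, le_div_iff₀ (by positivity)]
    exact mul_le_mul_of_nonneg_left h2 (by positivity)
  · refine (ae_restrict_iff' measurableSet_Ioi).2 (Eventually.of_forall fun w hw => ?_)
    have hw0 : 0 < w := hw
    simp only [Pi.zero_apply]
    positivity

/-- Watson's lemma for the exponent `-x w ^ 3 / 3`. -/
lemma cubic_watson {g : ℝ → ℂ} {c : ℕ → ℂ} {N : ℕ} {δ C : ℝ} (hδ : 0 < δ)
    (hg : ContinuousOn g (Set.Icc 0 δ))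
    (hC : ∀ w ∈ Set.Icc 0 δ, ‖g w - ∑ k ∈ Finset.range N, c k * (w : ℂ) ^ k‖ ≤ C * w ^ N) :
    ∃ D : ℝ, ∀ x : ℝ, 0 < x →
      ‖(∫ w in (0 : ℝ)..δ, Complex.exp (-(x * (w : ℂ) ^ 3 / 3)) * g w) -
        ∑ k ∈ Finset.range N, c k * cubicMoment k x‖ ≤ D * cubicMoment N x := by
  have hC0 : 0 ≤ C := by
    have h1 := (norm_nonneg _).trans (hC δ ⟨hδ.le, le_rfl⟩)
    exact nonneg_of_mul_nonneg_left h1 (by positivity)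
  refine ⟨C + ∑ k ∈ Finset.range N, ‖c k‖ * (δ ^ (N - k))⁻¹, fun x hx => ?_⟩
  set E : ℝ → ℂ := fun w => Complex.exp (-(x * (w : ℂ) ^ 3 / 3)) with hE
  have hEr (w : ℝ) : E w = ((Real.exp (-(x * w ^ 3 / 3)) : ℝ) : ℂ) := by
    rw [hE]; push_cast; rfl
  have hEc : Continuous E := by rw [hE]; fun_prop
  have hmono (k : ℕ) (w : ℝ) : E w * (w : ℂ) ^ k =
      ((w ^ k * Real.exp (-(x * w ^ 3 / 3)) : ℝ) : ℂ) := by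
    rw [hEr]; push_cast; ring
  have hint (k : ℕ) : IntegrableOn (fun w : ℝ => E w * (w : ℂ) ^ k) (Set.Ioi 0) := by
    simp_rw [hmono]
    exact (integrableOn_pow_mul_exp_cubic k hx).ofReal
  have hsplit (k : ℕ) : (∫ w in (0 : ℝ)..δ, E w * (w : ℂ) ^ k) = cubicMoment k x -
      ((∫ w in Set.Ioi δ, w ^ k * Real.exp (-(x * w ^ 3 / 3)) : ℝ) : ℂ) := by
    have h1 := setIntegral_union (μ := volume) (Set.Ioc_disjoint_Ioi le_rfl) measurableSet_Ioi
      ((hint k).mono_set Set.Ioc_subset_Ioi_self)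
      ((hint k).mono_set (Set.Ioi_subset_Ioi hδ.le))
    rw [Set.Ioc_union_Ioi_eq_Ioi hδ.le] at h1
    rw [intervalIntegral.integral_of_le hδ.le, eq_sub_iff_add_eq,
      ← integral_pow_mul_exp_cubic k hx, ← integral_complex_ofReal, ← integral_complex_ofReal]
    simp_rw [← hmono]
    exact h1.symm
  have hEg : IntervalIntegrable (fun w => E w * g w) volume 0 δ :=
    ContinuousOn.intervalIntegrable (by
      rw [Set.uIcc_of_le hδ.le]; exact hEc.continuousOn.mul hg)
  have hEs (k : ℕ) : IntervalIntegrable (fun w : ℝ => c k * (E w * (w : ℂ) ^ k)) volume 0 δ :=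
    Continuous.intervalIntegrable (by fun_prop) _ _
  have hsum : (∫ w in (0 : ℝ)..δ, ∑ k ∈ Finset.range N, c k * (E w * (w : ℂ) ^ k)) =
      ∑ k ∈ Finset.range N, c k * (cubicMoment k x -
        ((∫ w in Set.Ioi δ, w ^ k * Real.exp (-(x * w ^ 3 / 3)) : ℝ) : ℂ)) := by
    rw [intervalIntegral.integral_finsetSum fun k _ => hEs k]
    refine Finset.sum_congr rfl fun k _ => ?_
    rw [intervalIntegral.integral_const_mul, hsplit]
  have hmain : (∫ w in (0 : ℝ)..δ, E w * g w) - ∑ k ∈ Finset.range N, c k * cubicMoment k x =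
      (∫ w in (0 : ℝ)..δ, E w * (g w - ∑ k ∈ Finset.range N, c k * (w : ℂ) ^ k)) -
        ∑ k ∈ Finset.range N, c k *
          ((∫ w in Set.Ioi δ, w ^ k * Real.exp (-(x * w ^ 3 / 3)) : ℝ) : ℂ) := by
    have h1 : (∫ w in (0 : ℝ)..δ, E w * (g w - ∑ k ∈ Finset.range N, c k * (w : ℂ) ^ k)) =
        (∫ w in (0 : ℝ)..δ, E w * g w) -
          ∫ w in (0 : ℝ)..δ, ∑ k ∈ Finset.range N, c k * (E w * (w : ℂ) ^ k) := by
      rw [← intervalIntegral.integral_sub hEg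
        (Continuous.intervalIntegrable (by fun_prop) _ _)]
      congr 1; funext w
      rw [mul_sub, Finset.mul_sum]
      congr 1
      exact Finset.sum_congr rfl fun k _ => by ring
    rw [h1, hsum]
    simp_rw [mul_sub]
    rw [Finset.sum_sub_distrib]
    ring
  rw [hmain, add_mul]
  refine (norm_sub_le _ _).trans (add_le_add ?_ ?_)
  · have hN := integrableOn_pow_mul_exp_cubic N hx
    rw [intervalIntegral.integral_of_le hδ.le]
    have h1 : ‖∫ w in Set.Ioc 0 δ, E w * (g w - ∑ k ∈ Finset.range N, c k * (w : ℂ) ^ k)‖ ≤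
        ∫ w in Set.Ioc 0 δ, C * (w ^ N * Real.exp (-(x * w ^ 3 / 3))) := by
      refine norm_integral_le_of_norm_le
        ((hN.mono_set Set.Ioc_subset_Ioi_self).const_mul C) ?_
      refine (ae_restrict_iff' measurableSet_Ioc).2 (Eventually.of_forall fun w hw => ?_)
      rw [norm_mul, hEr, Complex.norm_real, Real.norm_of_nonneg (Real.exp_pos _).le]
      have := mul_le_mul_of_nonneg_left (hC w ⟨hw.1.le, hw.2⟩)
        (Real.exp_pos (-(x * w ^ 3 / 3))).le
      linarith
    refine h1.trans ?_
    rw [← integral_pow_mul_exp_cubic N hx, ← integral_const_mul]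
    refine setIntegral_mono_set (hN.const_mul C) ?_
      (LE.le.eventuallyLE Set.Ioc_subset_Ioi_self)
    refine (ae_restrict_iff' measurableSet_Ioi).2 (Eventually.of_forall fun w hw => ?_)
    have hw0 : 0 < w := hw
    simp only [Pi.zero_apply]
    positivity
  · rw [Finset.sum_mul]
    refine (norm_sum_le _ _).trans (Finset.sum_le_sum fun k hk => ?_)
    rw [norm_mul, Complex.norm_real, Real.norm_of_nonneg, mul_assoc]
    · exact mul_le_mul_of_nonneg_left (integral_tail_pow_mul_exp_cubic_le
        (Finset.mem_range.1 hk).le hδ hx) (norm_nonneg _)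
    · refine setIntegral_nonneg measurableSet_Ioi fun w hw => ?_
      have hw0 : 0 < w := hδ.trans hw
      positivity

end CubicWatson

/-! ### Exponentially small contributions away from the saddle. -/

section PathEstimates

open MeasureTheory

open scoped ComplexConjugate

variable {lam a x : ℝ}

lemma phase_doubleSaddle_eq_re (lam a : ℝ) : phase lam a (doubleSaddle lam) =
    ((phase lam a (doubleSaddle lam)).re : ℂ) := by
  refine (Complex.conj_eq_iff_re.1 ?_).symm
  rw [← phase_conj, Complex.conj_ofReal]

lemma norm_cexp_phase (hlam : 0 < lam)
    (ha : a = (1 + lam) / 2 * lam ^ ((1 - lam) / (1 + lam))) (x : ℝ) (t : ℂ) :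
    ‖Complex.exp (x * phase lam a (doubleSaddle lam + t))‖ =
      Real.exp (x * (phase lam a (doubleSaddle lam)).re) *
        Real.exp (x * (bigH lam / 12 * (saddleShift lam t).re)) := by
  have h : (bigH lam / 12 * saddleShift lam t : ℂ) =
      ((bigH lam / 12 : ℝ) : ℂ) * saddleShift lam t := by push_cast; rfl
  rw [phase_doubleSaddle_add hlam ha, Complex.norm_exp, Complex.re_ofReal_mul, Complex.add_re, h,
    Complex.re_ofReal_mul, mul_add, Real.exp_add]

/-- Along a compact convex set below the saddle the primitive varies by an exponentially small
amount. -/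
lemma exists_primitive_sub_le (hlam : 0 < lam)
    (ha : a = (1 + lam) / 2 * lam ^ ((1 - lam) / (1 + lam))) {S : Set ℂ} (hS : IsCompact S)
    (hconv : Convex ℝ S) (hneg : ∀ t ∈ S, (saddleShift lam t).re < 0) {A B : ℂ} (hA : A ∈ S)
    (hB : B ∈ S) : ∃ η : ℝ, 0 < η ∧ ∃ D : ℝ, 0 ≤ D ∧ ∀ x : ℝ, 0 < x → ∀ P : ℂ → ℂ,
      (∀ u, HasDerivAt P (Complex.exp (x * phase lam a u)) u) →
      ‖P (doubleSaddle lam + B) - P (doubleSaddle lam + A)‖ ≤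
        D * (Real.exp (x * (phase lam a (doubleSaddle lam)).re) * Real.exp (-η * x)) := by
  have hcont : ContinuousOn (fun t => (saddleShift lam t).re) S :=
    (Complex.continuous_re.comp (differentiable_saddleShift hlam).continuous).continuousOn
  -- Compactness turns pointwise negativity into a uniform gap, so `η` is independent of `x`; the
  -- mean value inequality on the convex set does the rest.
  obtain ⟨t₀, ht₀, hmax⟩ := hS.exists_isMaxOn ⟨A, hA⟩ hcont
  refine ⟨-(bigH lam / 12 * (saddleShift lam t₀).re), ?_, ‖B - A‖, norm_nonneg _, ?_⟩
  · have := mul_neg_of_pos_of_neg (show 0 < bigH lam / 12 by have := bigH_pos hlam; positivity)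
      (hneg t₀ ht₀)
    linarith
  · intro x hx P hP
    have h := hconv.norm_image_sub_le_of_norm_hasDerivWithin_le (𝕜 := ℂ)
      (f := fun t => P (doubleSaddle lam + t))
      (f' := fun t => Complex.exp (x * phase lam a (doubleSaddle lam + t)))
      (C := Real.exp (x * (phase lam a (doubleSaddle lam)).re) *
        Real.exp (x * (bigH lam / 12 * (saddleShift lam t₀).re)))
      (fun t _ => ((hP _).comp_const_add (doubleSaddle lam : ℂ) t).hasDerivWithinAt)
      (fun t ht => by
        rw [norm_cexp_phase hlam ha]
        have h1 : (saddleShift lam t).re ≤ (saddleShift lam t₀).re := hmax ht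
        have h2 := bigH_pos hlam
        gcongr) hA hB
    rw [mul_comm ‖B - A‖]
    refine h.trans_eq ?_
    congr 3; ring

/-- The end of the ray of angle `π / 3` at height `π / 2`. -/
def rayEnd : ℂ := ((Real.pi / (2 * √3) : ℝ) : ℂ) + (Real.pi / 2 : ℝ) * Complex.I

lemma rayEnd_eq : rayEnd = ((Real.pi / (2 * √3) : ℝ) : ℂ) * (1 + √3 * Complex.I) := by
  have h : (Real.pi / 2 : ℝ) = Real.pi / (2 * √3) * √3 := by field_simp
  rw [rayEnd, h]; push_cast; ring

lemma re_saddleShift_rayEnd_neg (hlam : 0 < lam) : (saddleShift lam rayEnd).re < 0 := by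
  rw [rayEnd_eq]
  exact re_saddleShift_ray_neg hlam (by positivity) le_rfl

lemma exists_primitive_sub_rayEnd_le (hlam : 0 < lam)
    (ha : a = (1 + lam) / 2 * lam ^ ((1 - lam) / (1 + lam))) {r : ℝ} (hr : 0 < r)
    (hrb : r ≤ Real.pi / (2 * √3)) :
    ∃ η : ℝ, 0 < η ∧ ∃ D : ℝ, 0 ≤ D ∧ ∀ x : ℝ, 0 < x → ∀ P : ℂ → ℂ,
      (∀ u, HasDerivAt P (Complex.exp (x * phase lam a u)) u) →
      ‖P (doubleSaddle lam + rayEnd) - P (doubleSaddle lam + r * (1 + √3 * Complex.I))‖ ≤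
        D * (Real.exp (x * (phase lam a (doubleSaddle lam)).re) * Real.exp (-η * x)) := by
  set f : ℝ →ₗ[ℝ] ℂ := LinearMap.toSpanSingleton ℝ ℂ (1 + √3 * Complex.I) with hf
  have hfr (r : ℝ) : f r = r * (1 + √3 * Complex.I) := by
    rw [hf, LinearMap.toSpanSingleton_apply, Complex.real_smul]
  refine exists_primitive_sub_le hlam ha (S := f '' Set.Icc r (Real.pi / (2 * √3)))
    (isCompact_Icc.image (LinearMap.continuous_of_finiteDimensional f))
    ((convex_Icc _ _).linear_image f) ?_ ⟨r, ⟨le_rfl, hrb⟩, hfr r⟩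
    ⟨Real.pi / (2 * √3), ⟨hrb, le_rfl⟩, by rw [rayEnd_eq, hfr]⟩
  rintro _ ⟨s, hs, rfl⟩
  rw [hfr]
  exact re_saddleShift_ray_neg hlam (hr.trans_le hs.1) hs.2

lemma exists_limit_sub_rayEnd_le (hlam : 0 < lam)
    (ha : a = (1 + lam) / 2 * lam ^ ((1 - lam) / (1 + lam))) :
    ∃ η : ℝ, 0 < η ∧ ∃ D : ℝ, 0 ≤ D ∧ ∀ x : ℝ, 1 ≤ x → ∀ P : ℂ → ℂ,
      (∀ u, HasDerivAt P (Complex.exp (x * phase lam a u)) u) → ∃ L : ℂ,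
      Tendsto (fun ρ : ℝ => P (ρ + (Real.pi / 2 : ℝ) * Complex.I)) atTop (𝓝 L) ∧
      ‖L - P (doubleSaddle lam + rayEnd)‖ ≤
        D * (Real.exp (x * (phase lam a (doubleSaddle lam)).re) * Real.exp (-η * x)) := by
  have hH := bigH_pos hlam
  set r₁ : ℝ := Real.pi / (2 * √3) with hr₁
  have hr0 : 0 ≤ r₁ := by positivity
  set c : ℝ := bigH lam / 12 * (6 / (1 + lam)) with hc
  have hc0 : 0 < c := by positivity
  set η : ℝ := -(bigH lam / 12 * (saddleShift lam rayEnd).re) with hη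
  have hη0 : 0 < η := by
    have := mul_neg_of_pos_of_neg (show 0 < bigH lam / 12 by positivity)
      (re_saddleShift_rayEnd_neg hlam)
    linarith
  refine ⟨η, hη0, 1 / c, by positivity, fun x hx P hP => ?_⟩
  have hx0 : 0 < x := by linarith
  set M : ℝ := Real.exp (x * (phase lam a (doubleSaddle lam)).re) with hM
  set f : ℝ → ℂ := fun ρ => P (doubleSaddle lam + (ρ + (Real.pi / 2 : ℝ) * Complex.I)) with hf
  set f' : ℝ → ℂ := fun ρ => Complex.exp (x * phase lam a (doubleSaddle lam +
    (ρ + (Real.pi / 2 : ℝ) * Complex.I))) with hf'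
  have hd (ρ : ℝ) : HasDerivAt f (f' ρ) ρ := by
    have h1 : HasDerivAt (fun ρ : ℝ => (doubleSaddle lam : ℂ) +
        (ρ + (Real.pi / 2 : ℝ) * Complex.I)) 1 ρ := by
      simpa using (((hasDerivAt_id ρ).ofReal_comp).add_const
        ((Real.pi / 2 : ℝ) * Complex.I)).const_add (doubleSaddle lam : ℂ)
    exact ((hP _).comp ρ h1).congr_deriv (by rw [mul_one])
  set bd : ℝ → ℝ := fun ρ => M * Real.exp (-η * x) * Real.exp (x * c * r₁) *
    Real.exp (-(x * c) * ρ) with hbd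
  have hbound : ∀ ρ ∈ Set.Ioi r₁, ‖f' ρ‖ ≤ bd ρ := by
    intro ρ hρ
    have h1 := re_saddleShift_horizontal_le hlam hr0 (le_of_lt hρ)
    rw [hf', hbd]
    simp only
    rw [norm_cexp_phase hlam ha, ← hM, mul_assoc, mul_assoc, ← Real.exp_add (x * c * r₁),
      ← Real.exp_add (-η * x)]
    refine mul_le_mul_of_nonneg_left (Real.exp_le_exp.2 ?_) (Real.exp_pos _).le
    have h2 : (saddleShift lam (r₁ + (Real.pi / 2 : ℝ) * Complex.I)).re =
      (saddleShift lam rayEnd).re := rfl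
    rw [h2] at h1
    have h3 := mul_le_mul_of_nonneg_left h1 (show 0 ≤ x * (bigH lam / 12) by positivity)
    rw [hη, hc]
    linarith
  have hbint : IntegrableOn bd (Set.Ioi r₁) :=
    (integrableOn_exp_mul_Ioi (by have := mul_pos hx0 hc0; linarith) r₁).const_mul _
  have hf'c : Continuous f' := by
    have := (differentiable_phase lam a).continuous
    rw [hf']; fun_prop
  have hint : IntegrableOn f' (Set.Ioi r₁) :=
    hbint.mono' hf'c.aestronglyMeasurable
      ((ae_restrict_iff' measurableSet_Ioi).2 (Eventually.of_forall hbound))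
  -- Integrability of the derivative supplies the existence of the limit. Translation by the real
  -- number `u₀` does not change the horizontal line.
  have hlim := tendsto_limUnder_of_hasDerivAt_of_integrableOn_Ioi (fun ρ _ => hd ρ) hint
  refine ⟨limUnder atTop f, ?_, ?_⟩
  · have h := hlim.comp (tendsto_atTop_add_const_right atTop (-doubleSaddle lam) tendsto_id)
    refine h.congr fun ρ => ?_
    simp only [hf, Function.comp_apply, id]
    congr 1; push_cast; ring
  · have h1 := integral_Ioi_of_hasDerivAt_of_tendsto' (fun ρ _ => hd ρ) hint hlim
    have h2 : f r₁ = P (doubleSaddle lam + rayEnd) := rfl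
    rw [← h2, ← h1]
    refine (norm_integral_le_of_norm_le hbint
      ((ae_restrict_iff' measurableSet_Ioi).2 (Eventually.of_forall hbound))).trans ?_
    rw [hbd, integral_const_mul, integral_exp_mul_Ioi (by have := mul_pos hx0 hc0; linarith)]
    have h3 : Real.exp (x * c * r₁) * Real.exp (-(x * c) * r₁) = 1 := by
      rw [← Real.exp_add]; simp
    have h4 : M * Real.exp (-η * x) * Real.exp (x * c * r₁) *
        (-Real.exp (-(x * c) * r₁) / -(x * c)) =
        (M * Real.exp (-η * x)) * (1 / (x * c)) := by
      rw [neg_div_neg_eq]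
      linear_combination (M * Real.exp (-η * x) / (x * c)) * h3
    rw [h4, mul_comm]
    refine mul_le_mul_of_nonneg_right ?_ (by positivity)
    -- Integrating the linear decay produces `1/(xc)`; the assumption `x ≥ 1` makes it at most
    -- `1/c`.
    exact one_div_le_one_div_of_le hc0 (le_mul_of_one_le_left hc0.le hx)

end PathEstimates

/-! ### Assembly of the asymptotic expansion. -/

section SaddleExpansion

open MeasureTheory

open scoped ComplexConjugate

variable {lam a : ℝ}

lemma cexp_pi_third : Complex.exp ((Real.pi : ℂ) * Complex.I / 3) =
    (1 + √3 * Complex.I) / 2 := by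
  have h : (Real.pi : ℂ) * Complex.I / 3 = ((Real.pi / 3 : ℝ) : ℂ) * Complex.I := by
    push_cast; ring
  rw [h, Complex.exp_mul_I, ← Complex.ofReal_cos, ← Complex.ofReal_sin, Real.cos_pi_div_three,
    Real.sin_pi_div_three]
  push_cast; ring

lemma norm_two_rpow_div_mul_cexp (hlam : 0 < lam) :
    ‖(((2 : ℝ) ^ (2 / 3 : ℝ) / bigH lam ^ (1 / 3 : ℝ) : ℝ) : ℂ) *
      Complex.exp ((Real.pi : ℂ) * Complex.I / 3)‖ =
      (2 : ℝ) ^ (2 / 3 : ℝ) / bigH lam ^ (1 / 3 : ℝ) := by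
  have hH := bigH_pos hlam
  rw [norm_mul, Complex.norm_real, Real.norm_of_nonneg (by positivity), Complex.norm_exp]
  simp

/-- In a narrow sector around a descent direction the cubic behaviour forces
`Re (saddleShift lam t) < 0`. -/
lemma eventually_re_saddleShift_neg (hlam : 0 < lam) {c : ℂ} {m : ℝ} (hm : 0 < m)
    (hc : c ^ 3 = -(m : ℂ)) : ∀ᶠ δ : ℝ in 𝓝[>] 0, ∀ t : ℂ, ‖t - c * δ‖ ≤ ‖c‖ * δ / 10 →
      (saddleShift lam t).re < 0 := by
  obtain ⟨G, hG, hG0, hfac⟩ := exists_saddleShift_factor hlam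
  have hc0 : c ≠ 0 := by
    rintro rfl
    have : m = 0 := by simpa using hc
    exact hm.ne' this
  have hcn : 0 < ‖c‖ := norm_pos_iff.2 hc0
  have hGn : ∀ᶠ t in 𝓝 (0 : ℂ), ‖G t - 1‖ < 1 / 10 := by
    have h := hG.continuousAt.eventually (Metric.ball_mem_nhds (G 0) (show (0 : ℝ) < 1 / 10 by
      norm_num))
    filter_upwards [h] with t ht
    rwa [hG0, dist_eq_norm] at ht
  obtain ⟨ε, hε, hball⟩ := Metric.eventually_nhds_iff_ball.1 (hfac.and hGn)
  filter_upwards [Ioo_mem_nhdsGT (show (0 : ℝ) < ε / (2 * ‖c‖) by positivity)] with δ hδ t ht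
  have hδ0 : 0 < δ := hδ.1
  have hδ1 : δ * (2 * ‖c‖) < ε := (lt_div_iff₀ (by positivity)).1 hδ.2
  have hcδ : c * δ ≠ 0 := mul_ne_zero hc0 (by exact_mod_cast hδ0.ne')
  have hcδn : ‖c * δ‖ = ‖c‖ * δ := by
    rw [norm_mul, Complex.norm_real, Real.norm_of_nonneg hδ0.le]
  have htn : ‖t‖ ≤ ‖c‖ * δ + ‖c‖ * δ / 10 := by
    have := norm_add_le (c * δ) (t - c * δ)
    rw [add_sub_cancel, hcδn] at this
    linarith
  obtain ⟨hK, hGt⟩ := hball t (by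
    rw [mem_ball_zero_iff]
    have := mul_pos hcn hδ0
    linarith)
  set s : ℂ := t / (c * δ) with hs
  have hts : t = c * δ * s := by rw [hs, mul_div_cancel₀ _ hcδ]
  have hs1 : ‖s - 1‖ ≤ 1 / 10 := by
    have h : s - 1 = (t - c * δ) / (c * δ) := by rw [hs, sub_div, div_self hcδ]
    rw [h, norm_div, hcδn, div_le_iff₀ (by positivity)]
    linarith
  have hsn : ‖s‖ ≤ 11 / 10 := by
    have := norm_add_le 1 (s - 1)
    rw [add_sub_cancel, norm_one] at this
    linarith
  have hG2 : ‖G t‖ ≤ 11 / 10 := by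
    have := norm_add_le 1 (G t - 1)
    rw [add_sub_cancel, norm_one] at this
    linarith
  have hval : saddleShift lam t = ((-(m * δ ^ 3) : ℝ) : ℂ) * (s ^ 3 * G t) := by
    have e : t ^ 3 = c ^ 3 * δ ^ 3 * s ^ 3 := by rw [hts]; ring
    rw [hK, e, hc]; push_cast; ring
  -- With `s` and `G t` within `1/10` of `1`, the left side is at most `(1/10)·4·(11/10) + 1/10 =
  -- 0.54`, so the product has positive real part.
  have hnear : ‖s ^ 3 * G t - 1‖ < 1 := by
    have e : s ^ 3 * G t - 1 = (s - 1) * (s ^ 2 + s + 1) * G t + (G t - 1) := by ring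
    have h1 : ‖s ^ 2 + s + 1‖ ≤ 4 := by
      have h2 := norm_add_le (s ^ 2 + s) 1
      have h3 := norm_add_le (s ^ 2) s
      rw [norm_pow] at h3
      rw [norm_one] at h2
      nlinarith [norm_nonneg s]
    rw [e]
    refine (norm_add_le _ _).trans_lt ?_
    rw [norm_mul, norm_mul]
    have h4 : ‖s - 1‖ * ‖s ^ 2 + s + 1‖ ≤ 1 / 10 * 4 :=
      mul_le_mul hs1 h1 (norm_nonneg _) (by norm_num)
    have h5 : ‖s - 1‖ * ‖s ^ 2 + s + 1‖ * ‖G t‖ ≤ 1 / 10 * 4 * (11 / 10) :=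
      mul_le_mul h4 hG2 (norm_nonneg _) (by norm_num)
    linarith
  have hre : 0 < (s ^ 3 * G t).re := by
    have h1 := (Complex.abs_re_le_norm (s ^ 3 * G t - 1)).trans_lt hnear
    rw [Complex.sub_re, Complex.one_re, abs_lt] at h1
    linarith [h1.1]
  rw [hval, Complex.re_ofReal_mul]
  have : 0 < m * δ ^ 3 := by positivity
  nlinarith [mul_pos this hre]

/-- The coefficients in the expansion of `du / dw`. -/
def branchCoeff (lam : ℝ) (B : ℕ → ℝ) (k : ℕ) : ℂ :=
  (((2 : ℝ) ^ (2 / 3 : ℝ) / bigH lam ^ (1 / 3 : ℝ) : ℝ) : ℂ) *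
    (Complex.exp ((Real.pi : ℂ) * Complex.I * ((k : ℂ) + 1) / 3) *
      ((B k / bigH lam ^ ((k : ℝ) / 3) : ℝ) : ℂ))

lemma exists_partialSum_bound {f : ℂ → ℂ} {c : ℕ → ℂ}
    (h : ∀ᶠ z in 𝓝 (0 : ℂ), HasSum (fun k => c k * z ^ k) (f z)) (N : ℕ) :
    ∃ C : ℝ, ∀ᶠ z in 𝓝 (0 : ℂ),
      ‖f z - ∑ k ∈ Finset.range N, c k * z ^ k‖ ≤ C * ‖z‖ ^ N := by
  have hp : HasFPowerSeriesAt f (FormalMultilinearSeries.ofScalars ℂ c) 0 := by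
    rw [hasFPowerSeriesAt_iff]
    filter_upwards [h] with z hz
    simpa [mul_comm] using hz
  obtain ⟨C, hC⟩ := (hp.isBigO_sub_partialSum_pow N).bound
  refine ⟨C, hC.mono fun z hz => ?_⟩
  rw [zero_add, norm_pow, norm_norm] at hz
  refine le_trans (le_of_eq ?_) hz
  congr 2
  simp [FormalMultilinearSeries.partialSum, mul_comm]

/-- Along the branch `h(U(w)) = h(u₀) - w³/3` holds exactly, so integrating the derivative of `P ∘
U` from `0` to `δ` gives a Watson integral with no phase error. -/
lemma primitive_branch_eq {U P : ℂ → ℂ} (hU0 : U 0 = doubleSaddle lam)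
    (hP0 : P (doubleSaddle lam) = 0) {x δ : ℝ} (hδ : 0 < δ)
    (hP : ∀ u, HasDerivAt P (Complex.exp (x * phase lam a u)) u)
    (hUan : ∀ w ∈ Set.Icc (0 : ℝ) δ, AnalyticAt ℂ U w)
    (hphase : ∀ w ∈ Set.Icc (0 : ℝ) δ,
      phase lam a (U w) - phase lam a (doubleSaddle lam) = -(w : ℂ) ^ 3 / 3) :
    P (U δ) = (Real.exp (x * (phase lam a (doubleSaddle lam)).re) : ℂ) *
      ∫ w in (0 : ℝ)..δ, Complex.exp (-(x * (w : ℂ) ^ 3 / 3)) * deriv U w := by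
  have hcont : ContinuousOn (fun w : ℝ => deriv U w) (Set.Icc 0 δ) := fun w hw =>
    ((hUan w hw).deriv.continuousAt.comp
      Complex.continuous_ofReal.continuousAt).continuousWithinAt
  have hd : ∀ w ∈ Set.uIcc 0 δ, HasDerivAt (fun w : ℝ => P (U w))
      ((Real.exp (x * (phase lam a (doubleSaddle lam)).re) : ℂ) *
        (Complex.exp (-(x * (w : ℂ) ^ 3 / 3)) * deriv U w)) w := by
    intro w hw
    rw [Set.uIcc_of_le hδ.le] at hw
    have h1 := ((hP (U w)).comp (w : ℂ) (hUan w hw).differentiableAt.hasDerivAt).comp_ofReal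
    refine h1.congr_deriv ?_
    have h2 : (x : ℂ) * phase lam a (U w) =
        ((x * (phase lam a (doubleSaddle lam)).re : ℝ) : ℂ) + -(x * (w : ℂ) ^ 3 / 3) := by
      rw [sub_eq_iff_eq_add.1 (hphase w hw), Complex.ofReal_mul, ← phase_doubleSaddle_eq_re]
      ring
    rw [h2, Complex.exp_add, ← Complex.ofReal_exp, mul_assoc]
  have hint : IntervalIntegrable (fun w : ℝ =>
      (Real.exp (x * (phase lam a (doubleSaddle lam)).re) : ℂ) *
        (Complex.exp (-(x * (w : ℂ) ^ 3 / 3)) * deriv U w)) volume 0 δ := by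
    refine ContinuousOn.intervalIntegrable ?_
    rw [Set.uIcc_of_le hδ.le]
    exact continuousOn_const.mul (ContinuousOn.mul (by fun_prop) hcont)
  have h := intervalIntegral.integral_eq_sub_of_hasDerivAt hd hint
  rw [intervalIntegral.integral_const_mul, Complex.ofReal_zero, hU0, hP0, sub_zero] at h
  exact h.symm

/-- The integral over the upper half path, up to a remainder of the order of the first neglected
term and exponentially small ones. -/
lemma exists_contour_bound (hlam : 0 < lam)
    (ha : a = (1 + lam) / 2 * lam ^ ((1 - lam) / (1 + lam))) {B : ℕ → ℝ}
    (hB : IsSaddleCoeff lam a B) (N : ℕ) :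
    ∃ S : ℝ → ℝ, S =O[atTop] (fun x : ℝ => x ^ (-((N : ℝ) + 1) / 3)) ∧
      ∀ x : ℝ, 1 ≤ x → ∀ P : ℂ → ℂ, P (doubleSaddle lam) = 0 →
      (∀ u, HasDerivAt P (Complex.exp (x * phase lam a u)) u) → ∃ L : ℂ,
      Tendsto (fun ρ : ℝ => P (ρ + (Real.pi / 2 : ℝ) * Complex.I)) atTop (𝓝 L) ∧
      ‖L - (Real.exp (x * (phase lam a (doubleSaddle lam)).re) : ℂ) *
        ∑ k ∈ Finset.range N, branchCoeff lam B k * cubicMoment k x‖ ≤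
        Real.exp (x * (phase lam a (doubleSaddle lam)).re) * S x := by
  obtain ⟨U, hU, hsum⟩ := hB
  have hH := bigH_pos hlam
  set κ : ℝ := (2 : ℝ) ^ (2 / 3 : ℝ) / bigH lam ^ (1 / 3 : ℝ) with hκ
  have hκ0 : 0 < κ := by positivity
  set c : ℂ := (κ : ℂ) * Complex.exp ((Real.pi : ℂ) * Complex.I / 3) with hc
  have hcn : ‖c‖ = κ := norm_two_rpow_div_mul_cexp hlam
  have hc3 : c ^ 3 = -((4 / bigH lam : ℝ) : ℂ) := by
    rw [hc, mul_pow, cexp_pi_third_cube, ← Complex.ofReal_pow, two_rpow_div_cube hlam]; ring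
  -- The tangent point `cδ` lies on the ray of angle `π/3`, at parameter `r = κδ/2`.
  have hcray (δ : ℝ) : c * δ = ((κ * δ / 2 : ℝ) : ℂ) * (1 + √3 * Complex.I) := by
    rw [hc, cexp_pi_third]; push_cast; ring
  have hsum' : ∀ᶠ z in 𝓝 (0 : ℂ), HasSum (fun k => branchCoeff lam B k * z ^ k) (deriv U z) := by
    filter_upwards [hsum] with z hz
    refine hz.congr_fun fun k => ?_
    rw [branchCoeff]; ring
  obtain ⟨C, hC⟩ := exists_partialSum_bound hsum' N
  obtain ⟨ε, hε, hball⟩ := Metric.eventually_nhds_iff_ball.1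
    ((hC.and hU.analyticAt.eventually_analyticAt).and hU.phase_eq)
  have hlin : ∀ᶠ δ : ℝ in 𝓝[>] 0, ‖(U δ - doubleSaddle lam) - c * δ‖ ≤ ‖c‖ * δ / 10 := by
    have hd : HasDerivAt U c 0 := by
      rw [hc, ← hU.deriv_zero]; exact hU.analyticAt.differentiableAt.hasDerivAt
    have h1 := (hasDerivAt_iff_isLittleO.1 hd).def (show (0 : ℝ) < κ / 10 by positivity)
    have h2 : Tendsto (fun δ : ℝ => (δ : ℂ)) (𝓝[>] 0) (𝓝 0) :=
      tendsto_nhdsWithin_of_tendsto_nhds (by simpa using Complex.continuous_ofReal.tendsto 0)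
    filter_upwards [h2.eventually h1, self_mem_nhdsWithin] with δ h3 hδ
    have hδ0 : 0 < δ := hδ
    rw [hU.map_zero, sub_zero, smul_eq_mul, Complex.norm_real, Real.norm_of_nonneg hδ0.le] at h3
    rw [hcn, mul_comm c]
    linarith
  -- One `δ` must satisfy four demands: `U(δ) - u₀` lies in the ball of radius `|c|δ/10` about `cδ`,
  -- `Re K < 0` on that ball, the local expansions hold up to `δ`, and `cδ` does not pass the end of
  -- the ray.
  obtain ⟨δ, ⟨⟨hnear, hneg⟩, hδε⟩, hδr⟩ := (((hlin.and (eventually_re_saddleShift_neg hlam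
    (show 0 < 4 / bigH lam by positivity) hc3)).and (Ioo_mem_nhdsGT hε)).and
    (Ioo_mem_nhdsGT (show (0 : ℝ) < Real.pi / (2 * √3) / (κ / 2) by positivity))).exists
  have hδ0 : 0 < δ := hδε.1
  have hmem : ∀ w ∈ Set.Icc (0 : ℝ) δ, (w : ℂ) ∈ Metric.ball (0 : ℂ) ε := fun w hw => by
    rw [mem_ball_zero_iff, Complex.norm_real, Real.norm_of_nonneg hw.1]
    exact hw.2.trans_lt hδε.2
  have hr0 : 0 < κ * δ / 2 := by positivity
  have hr1 : κ * δ / 2 ≤ Real.pi / (2 * √3) := by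
    have := (lt_div_iff₀ (by positivity)).1 hδr.2
    linarith
  obtain ⟨D, hD⟩ := cubic_watson (g := fun w : ℝ => deriv U w) (c := branchCoeff lam B) (N := N)
    (C := C) hδ0
    (fun w hw => ((hball _ (hmem w hw)).1.2.deriv.continuousAt.comp
      Complex.continuous_ofReal.continuousAt).continuousWithinAt)
    (fun w hw => by
      have h := (hball _ (hmem w hw)).1.1
      rwa [Complex.norm_real, Real.norm_of_nonneg hw.1] at h)
  obtain ⟨η₁, hη₁, D₁, hD₁, h₁⟩ := exists_primitive_sub_le hlam ha
    (isCompact_closedBall (c * δ) (‖c‖ * δ / 10)) (convex_closedBall _ _)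
    (fun t ht => hneg t (mem_closedBall_iff_norm.1 ht))
    (A := U δ - doubleSaddle lam) (B := c * δ) (mem_closedBall_iff_norm.2 hnear)
    (Metric.mem_closedBall_self (by positivity))
  obtain ⟨η₂, hη₂, D₂, hD₂, h₂⟩ := exists_primitive_sub_rayEnd_le hlam ha hr0 hr1
  obtain ⟨η₃, hη₃, D₃, hD₃, h₃⟩ := exists_limit_sub_rayEnd_le hlam ha
  refine ⟨fun x => D₁ * Real.exp (-η₁ * x) + D₂ * Real.exp (-η₂ * x) + D₃ * Real.exp (-η₃ * x) +
    D * cubicMoment N x, ?_, fun x hx P hP0 hP => ?_⟩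
  · have hexp {η : ℝ} (hη : 0 < η) (D : ℝ) : (fun x : ℝ => D * Real.exp (-η * x)) =O[atTop]
        (fun x : ℝ => x ^ (-((N : ℝ) + 1) / 3)) :=
      ((isLittleO_exp_neg_mul_rpow_atTop hη _).isBigO).const_mul_left D
    refine (((hexp hη₁ D₁).add (hexp hη₂ D₂)).add (hexp hη₃ D₃)).add (IsBigO.const_mul_left ?_ D)
    refine IsBigO.of_bound ((3 ^ (-((N : ℝ) + 1) / 3))⁻¹ * (1 / 3) *
      Real.Gamma (((N : ℝ) + 1) / 3)) ?_
    filter_upwards [eventually_gt_atTop 0] with x hx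
    rw [Real.norm_of_nonneg (cubicMoment_nonneg N hx), Real.norm_of_nonneg (by positivity),
      cubicMoment, Real.div_rpow hx.le (by norm_num)]
    exact le_of_eq (by ring)
  · have hx0 : 0 < x := by linarith
    obtain ⟨L, hL, hLb⟩ := h₃ x hx P hP
    refine ⟨L, hL, ?_⟩
    have e1 := h₁ x hx0 P hP
    have e2 := h₂ x hx0 P hP
    rw [← hcray] at e2
    rw [add_sub_cancel, primitive_branch_eq hU.map_zero hP0 hδ0 hP
      (fun w hw => (hball _ (hmem w hw)).1.2) (fun w hw => (hball _ (hmem w hw)).2)] at e1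
    have e3 := mul_le_mul_of_nonneg_left (hD x hx0)
      (Real.exp_pos (x * (phase lam a (doubleSaddle lam)).re)).le
    set M : ℝ := Real.exp (x * (phase lam a (doubleSaddle lam)).re) with hM
    set I : ℂ := ∫ w in (0 : ℝ)..δ, Complex.exp (-(x * (w : ℂ) ^ 3 / 3)) * deriv U w
    set V : ℂ := ∑ k ∈ Finset.range N, branchCoeff lam B k * cubicMoment k x
    -- The four pieces of the path: half line, ray, segment inside the ball, and the Watson error on
    -- the steepest descent curve.
    have e4 : L - M * V = (L - P (doubleSaddle lam + rayEnd)) +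
        (P (doubleSaddle lam + rayEnd) - P (doubleSaddle lam + c * δ)) +
        (P (doubleSaddle lam + c * δ) - M * I) + M * (I - V) := by ring
    have e5 : ‖(M : ℂ) * (I - V)‖ = M * ‖I - V‖ := by
      rw [norm_mul, Complex.norm_real, Real.norm_of_nonneg (Real.exp_pos _).le]
    rw [e4]
    refine (norm_add_le _ _).trans ?_
    rw [e5]
    have e6 := norm_add_le ((L - P (doubleSaddle lam + rayEnd)) +
        (P (doubleSaddle lam + rayEnd) - P (doubleSaddle lam + c * δ)))
        (P (doubleSaddle lam + c * δ) - M * I)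
    have e7 := norm_add_le (L - P (doubleSaddle lam + rayEnd))
        (P (doubleSaddle lam + rayEnd) - P (doubleSaddle lam + c * δ))
    linarith

lemma branchCoeff_im (lam : ℝ) (B : ℕ → ℝ) (k : ℕ) : (branchCoeff lam B k).im =
    (2 : ℝ) ^ (2 / 3 : ℝ) / bigH lam ^ (1 / 3 : ℝ) * (B k / bigH lam ^ ((k : ℝ) / 3)) *
      Real.sin (Real.pi / 3 * ((k : ℝ) + 1)) := by
  have h : (Real.pi : ℂ) * Complex.I * ((k : ℂ) + 1) / 3 =
      ((Real.pi / 3 * ((k : ℝ) + 1) : ℝ) : ℂ) * Complex.I := by push_cast; ring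
  rw [branchCoeff, h, mul_comm (Complex.exp _), Complex.im_ofReal_mul, Complex.im_ofReal_mul,
    Complex.exp_ofReal_mul_I_im]
  ring

/-- Matches each term of the stated series with an imaginary part: the powers of `H` and of `x/3`
merge into powers of `Hx/3`, and the `1/3` in the prefactor is that of the cubic moment. -/
lemma saddlePrefactor_mul_saddleTerm (hlam : 0 < lam) (a : ℝ) (B : ℕ → ℝ) (k : ℕ) {x : ℝ}
    (hx : 0 < x) : Real.pi * (saddlePrefactor lam a x * saddleTerm lam B k x) =
      Real.exp (x * (phase lam a (doubleSaddle lam)).re) *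
        (branchCoeff lam B k * cubicMoment k x).im := by
  have hH := bigH_pos hlam
  have hx3 : 0 < x / 3 := by positivity
  rw [mul_comm (branchCoeff lam B k), Complex.im_ofReal_mul, branchCoeff_im, cubicMoment,
    saddlePrefactor, saddleTerm, mul_div_assoc (bigH lam), Real.mul_rpow hH.le hx3.le,
    Real.mul_rpow hH.le hx3.le, show -((k : ℝ) + 1) / 3 = -(1 / 3 + (k : ℝ) / 3) by ring,
    Real.rpow_neg hx3.le, Real.rpow_add hx3]
  have h1 := Real.rpow_pos_of_pos hH (1 / 3)
  have h2 := Real.rpow_pos_of_pos hH ((k : ℝ) / 3)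
  have h3 := Real.rpow_pos_of_pos hx3 (1 / 3)
  have h4 := Real.rpow_pos_of_pos hx3 ((k : ℝ) / 3)
  have := Real.pi_pos
  field_simp

/-- The prefactor already contains `(Hx/3)^(-1/3)`, so for `x > 0` the two sides are constant
multiples of each other. -/
lemma isBigO_saddlePrefactor (hlam : 0 < lam) (a : ℝ) (N : ℕ) :
    (fun x : ℝ => Real.exp (x * (phase lam a (doubleSaddle lam)).re) *
      x ^ (-((N : ℝ) + 1) / 3)) =O[atTop]
    (fun x : ℝ => saddlePrefactor lam a x * (bigH lam * x / 3) ^ (-(N : ℝ) / 3)) := by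
  have hH := bigH_pos hlam
  have hH3 : 0 < bigH lam / 3 := by positivity
  refine IsBigO.of_bound (3 * Real.pi / (2 : ℝ) ^ (2 / 3 : ℝ) *
    ((bigH lam / 3) ^ (-((N : ℝ) + 1) / 3))⁻¹) ?_
  filter_upwards [eventually_gt_atTop 0] with x hx
  have hy : 0 < bigH lam * x / 3 := by positivity
  have hy1 := Real.rpow_pos_of_pos hy (1 / 3)
  rw [saddlePrefactor, Real.norm_of_nonneg (by positivity), Real.norm_of_nonneg (by positivity)]
  have h1 : (bigH lam * x / 3) ^ (-(N : ℝ) / 3) =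
      (bigH lam / 3) ^ (-((N : ℝ) + 1) / 3) * x ^ (-((N : ℝ) + 1) / 3) *
        (bigH lam * x / 3) ^ (1 / 3 : ℝ) := by
    rw [← Real.mul_rpow hH3.le hx.le, show bigH lam / 3 * x = bigH lam * x / 3 by ring,
      ← Real.rpow_add hy]
    congr 1; ring
  have h2 := Real.rpow_pos_of_pos hH3 (-((N : ℝ) + 1) / 3)
  rw [h1]
  apply le_of_eq
  field_simp

lemma wrightMinus_isBigO (hlam : 0 < lam)
    (ha : a = (1 + lam) / 2 * lam ^ ((1 - lam) / (1 + lam))) {B : ℕ → ℝ}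
    (hB : IsSaddleCoeff lam a B) (N : ℕ) :
    (fun x : ℝ => wrightMinus lam (a * x) x -
      saddlePrefactor lam a x * ∑ k ∈ Finset.range N, saddleTerm lam B k x)
    =O[atTop]
    (fun x : ℝ => saddlePrefactor lam a x * (bigH lam * x / 3) ^ (-(N : ℝ) / 3)) := by
  obtain ⟨S, hS, hbound⟩ := exists_contour_bound hlam ha hB N
  refine IsBigO.trans ?_ (((isBigO_refl (fun x : ℝ =>
    Real.exp (x * (phase lam a (doubleSaddle lam)).re)) atTop).mul hS).trans
      (isBigO_saddlePrefactor hlam a N))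
  refine IsBigO.of_bound Real.pi⁻¹ ?_
  filter_upwards [eventually_ge_atTop 1] with x hx
  have hx0 : 0 < x := by linarith
  obtain ⟨P, hP0, hP, hconj⟩ := exists_primitive lam a x
  obtain ⟨L, hL, hLb⟩ := hbound x hx P hP0 hP
  have hW := pi_mul_wrightMinus hlam (speed_pos hlam ha) hx0 hP hconj hL
  have hsum : Real.pi * (saddlePrefactor lam a x * ∑ k ∈ Finset.range N, saddleTerm lam B k x) =
      ((Real.exp (x * (phase lam a (doubleSaddle lam)).re) : ℂ) *
        ∑ k ∈ Finset.range N, branchCoeff lam B k * cubicMoment k x).im := by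
    rw [Complex.im_ofReal_mul, Complex.im_sum, Finset.mul_sum, Finset.mul_sum, Finset.mul_sum]
    exact Finset.sum_congr rfl fun k _ => saddlePrefactor_mul_saddleTerm hlam a B k hx0
  have hdiff : Real.pi * |wrightMinus lam (a * x) x -
      saddlePrefactor lam a x * ∑ k ∈ Finset.range N, saddleTerm lam B k x| ≤
      Real.exp (x * (phase lam a (doubleSaddle lam)).re) * S x := by
    calc _ = |Real.pi * (wrightMinus lam (a * x) x - saddlePrefactor lam a x *
          ∑ k ∈ Finset.range N, saddleTerm lam B k x)| := by rw [abs_mul, abs_of_pos Real.pi_pos]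
      _ ≤ _ := by
        rw [mul_sub, hW, hsum, ← Complex.sub_im]
        exact (Complex.abs_im_le_norm _).trans hLb
  rw [Real.norm_eq_abs, inv_mul_eq_div, le_div_iff₀ Real.pi_pos, mul_comm]
  exact hdiff.trans (Real.le_norm_self _)

lemma saddleTerm_eq_zero (lam : ℝ) (B : ℕ → ℝ) {k : ℕ} (hk : k % 3 = 2) (x : ℝ) :
    saddleTerm lam B k x = 0 := by
  have h : Real.pi / 3 * ((k : ℝ) + 1) = ((k / 3 + 1 : ℕ) : ℝ) * Real.pi := by
    have hk' : k = 3 * (k / 3) + 2 := by omega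
    have hk'' : (k : ℝ) = 3 * ((k / 3 : ℕ) : ℝ) + 2 := by exact_mod_cast hk'
    push_cast
    rw [hk'']
    ring
  rw [saddleTerm, h, Real.sin_nat_mul_pi, mul_zero]

end SaddleExpansion

end

theorem mainTheorem3 (lam a : ℝ) (hlam : 0 < lam)
    (ha : a = (1 + lam) / 2 * lam ^ ((1 - lam) / (1 + lam))) :
    -- double saddle point
    deriv (phase lam a) (doubleSaddle lam : ℂ) = 0 ∧
    iteratedDeriv 2 (phase lam a) (doubleSaddle lam : ℂ) = 0 ∧
    (bigH lam : ℂ) = 2 * iteratedDeriv 3 (phase lam a) (doubleSaddle lam : ℂ) ∧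
    phase lam a (doubleSaddle lam : ℂ) =
      (((lam ^ 2 - 1) / (2 * lam ^ 2) * Real.exp (doubleSaddle lam) -
        lam ^ ((1 - lam) / (1 + lam)) * Real.log lam : ℝ) : ℂ) ∧
    -- coefficients
    ∃ B : ℕ → ℝ, IsSaddleCoeff lam a B ∧
      B 0 = 1 ∧
      B 1 = (lam - 1) / ((2 : ℝ) ^ (1 / 3 : ℝ) * 3) ∧
      B 2 = (1 - 6 * lam + lam ^ 2) / ((2 : ℝ) ^ (2 / 3 : ℝ) * 20) ∧
      B 3 = (5 + 93 * lam - 93 * lam ^ 2 - 5 * lam ^ 3) / 1620 ∧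
      B 4 = -(277 + 836 * lam - 6114 * lam ^ 2 + 836 * lam ^ 3 + 277 * lam ^ 4) /
        ((2 : ℝ) ^ (1 / 3 : ℝ) * 136080) ∧
      B 5 = (1 - 61 * lam - 254 * lam ^ 2 + 254 * lam ^ 3 + 61 * lam ^ 4 - lam ^ 5) /
        ((2 : ℝ) ^ (2 / 3 : ℝ) * 16800) ∧
      B 6 = (959 + 7098 * lam - 2031 * lam ^ 2 - 58708 * lam ^ 3 - 2031 * lam ^ 4 +
        7098 * lam ^ 5 + 959 * lam ^ 6) / 10497600 ∧
      -- asymptotic expansion as `x → +∞` with `ν = a x`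
      (∀ N : ℕ,
        (fun x : ℝ => wrightMinus lam (a * x) x -
          saddlePrefactor lam a x * ∑ k ∈ Finset.range N, saddleTerm lam B k x)
        =O[atTop]
        (fun x : ℝ => saddlePrefactor lam a x * (bigH lam * x / 3) ^ (-(N : ℝ) / 3))) ∧
      -- vanishing terms
      (∀ k : ℕ, k % 3 = 2 → ∀ x : ℝ, saddleTerm lam B k x = 0) := by
  obtain ⟨B, hB, hvals⟩ := exists_saddleCoeff hlam ha
  obtain ⟨h0, h1, h2, h3, h4, h5, h6⟩ := hvals
  exact ⟨deriv_phase_doubleSaddle hlam ha, iteratedDeriv_two_phase_doubleSaddle hlam,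
    iteratedDeriv_three_phase_doubleSaddle hlam, phase_doubleSaddle hlam ha, B, hB,
    h0, h1, h2, h3, h4, h5, h6, wrightMinus_isBigO hlam ha hB,
    fun k hk x => saddleTerm_eq_zero lam B hk x⟩
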